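/- **Notation.** Let $\mathbb F$ be a field. For an $n\times n$ matrix $A$ let $A_S$ be the principal minor of $A$ with rows and columns in $S\subseteq[n]$ ($A_\emptyset=1$); the principal minor map over a field sends $A$ to $(A_S)_{S\subseteq[n]}$. A vector $\mathbf a=(a_S)_{S\subseteq[n]}\in\mathbb F^{2^{[n]}}$ is identified with the multiaffine polynomial $f_{\mathbf a}=\sum_{S\subseteq[n]}a_S\prod_{i\in[n]\setminus S}x_i$, and $\mathbf a=\mathrm{coeff}(f_{\mathbf a})$ is its coefficient vector. The group $\mathrm{SL}_2(\mathbb F)^n\rtimes S_n$ acts on multiaffine polynomials: $S_n$ permutes the variables, and $\gamma=\left(\begin{pmatrix}a_i&b_i\\c_i&d_i\end{pmatrix}\right)_i$ acts by $$\gamma\cdot f=\prod_{i=1}^n(c_ix_i+d_i)\cdot f\Big(\tfrac{a_1x_1+b_1}{c_1x_1+d_1},\dots,\tfrac{a_nx_n+b_n}{c_nx_n+d_n}\Big).$$ Hence it acts on $\mathbb F[a_S:S\subseteq[n]]$ by linear substitutions. For a set $E$ of polynomials, $\mathcal V(E)$ is the set of its common zeros with coordinates in $\mathbb F$. For $N\le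 n$, regard $\mathbb F[a_S:S\subseteq[N]]$ as a subring of $\mathbb F[a_S:S\subseteq[n]]$. Let $\mathbb K$ be an infinite extension field of $\mathbb F$ ($\mathbb K=\mathbb F$ is allowed if $\mathbb F$ is infinite), and let $I_n\subset\mathbb F[a_S:S\subseteq[n]]$ be the ideal generated by the homogeneous polynomials that vanish on the image of $\mathbb K^{n\times n}$ under the principal minor map. For $i\ne j$ let $\Delta_{ij}(f)=\frac{\partial f}{\partial x_i}\frac{\partial f}{\partial x_j}-f\frac{\partial^2f}{\partial x_i\partial x_j}$. For $n\ge2$ put, with $x_{2n+2}=x_2$, $$f_{2n+1}=x_1\prod_{j=1}^n(x_{2j+1}x_{2j+2}+1)+\prod_{j=1}^n(x_{2j}x_{2j+1}+1).$$ **Theorem.** 1. No finite set of equations has an orbit under $\mathrm{SL}_2(\mathbb F)^n\rtimes S_n$ that set-theoretically cuts out the image of the principal minor map for all $n$. That is, for every $N$ and every finite set $E\subset\mathbb F[a_S:S\subseteq[N]]$: - (a) it is not the case that for all $n\ge N$ and all $\mathbf a\in\mathbb F^{2^{[n]}}$ with $a_\emptyset=1$, the vector $\mathbf a$ is the vector of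 principal minors of some matrix in $\mathbb F^{n\times n}$ if and only if $\mathbf a\in\mathcal V\big((\mathrm{SL}_2(\mathbb F)^n\rtimes S_n)\cdot E\big)$; - (b) nor is it the case that $\mathcal V\big((\mathrm{SL}_2(\mathbb F)^n\rtimes S_n)\cdot E\big)=\mathcal V(I_n)$ for all $n\ge N$. 2. For every $n\ge2$, $\mathrm{coeff}(f_{2n+1})\in\mathcal V\big((\mathrm{SL}_2(\mathbb F)^{2n+1}\rtimes S_{2n+1})\cdot I_{2n}\big)$, but $\mathrm{coeff}(f_{2n+1})\notin\mathcal V(I_{2n+1})$. Moreover $\Delta_{12}(f_{2n+1})$ is not a product of two polynomials that have degree at most one in each variable and coefficients in the algebraic closure of $\mathbb F$. -/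

import Mathlib

open MvPolynomial

noncomputable section

namespace PrincipalMinor

/-- The principal minor map: `A` goes to the vector `(A_S)` of the determinants of the square
submatrices of `A` with rows and columns indexed by `S`, over all `S ⊆ [n]`. -/
def principalMinors {R : Type*} [CommRing R] {n : ℕ} (A : Matrix (Fin n) (Fin n) R) :
    Finset (Fin n) → R :=
  fun S => (A.submatrix (fun i : S => (i : Fin n)) (fun i : S => (i : Fin n))).det

/-- The multiaffine polynomial `f_a = ∑_S a_S ∏_{i ∉ S} x_i` of a vector `a`. -/
def multiaffinePoly {R : Type*} [CommRing R] {n : ℕ} (a : Finset (Fin n) → R) :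
    MvPolynomial (Fin n) R :=
  ∑ S : Finset (Fin n), C (a S) * ∏ i ∈ Sᶜ, X i

/-- The coefficient vector of `f`: its entry at `S` is the coefficient of `∏_{i ∉ S} x_i`. -/
def coeffVec {R : Type*} [CommRing R] {n : ℕ} (f : MvPolynomial (Fin n) R) :
    Finset (Fin n) → R :=
  fun S => coeff (∑ i ∈ Sᶜ, Finsupp.single i 1) f

/-- The action of `γ ∈ SL₂(R)ⁿ`, `γ_i = (a_i, b_i; c_i, d_i)`, on a multiaffine polynomial `f`:
`∏ (c_i x_i + d_i) * f((a_1 x_1 + b_1)/(c_1 x_1 + d_1), …, (a_n x_n + b_n)/(c_n x_n + d_n))`.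
A monomial `∏_{i ∉ S} x_i` becomes `∏_{i ∉ S} (a_i x_i + b_i) * ∏_{i ∈ S} (c_i x_i + d_i)`. -/
def moebius {R : Type*} [CommRing R] {n : ℕ} (γ : Fin n → Matrix.SpecialLinearGroup (Fin 2) R)
    (f : MvPolynomial (Fin n) R) : MvPolynomial (Fin n) R :=
  ∑ S : Finset (Fin n), C (coeffVec f S) *
    ((∏ i ∈ Sᶜ, (C ((γ i).1 0 0) * X i + C ((γ i).1 0 1))) *
      ∏ i ∈ S, (C ((γ i).1 1 0) * X i + C ((γ i).1 1 1)))

/-- The action of the element `(γ, π)` of `SL₂(R)ⁿ ⋊ S_n` on coefficient vectors of multiaffine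
polynomials: first `π` permutes the variables, then `γ` acts. -/
def actVec {R : Type*} [CommRing R] {n : ℕ} (γ : Fin n → Matrix.SpecialLinearGroup (Fin 2) R)
    (π : Equiv.Perm (Fin n)) (a : Finset (Fin n) → R) : Finset (Fin n) → R :=
  coeffVec (moebius γ (rename π (multiaffinePoly a)))

/-- The induced action of `(γ, π)` on polynomials `P` in the variables `a_S`, by the linear
substitution `a ↦ (γ, π) · a`; see `eval_actPoly`. -/
def actPoly {R : Type*} [CommRing R] {n : ℕ} (γ : Fin n → Matrix.SpecialLinearGroup (Fin 2) R)
    (π : Equiv.Perm (Fin n)) (P : MvPolynomial (Finset (Fin n)) R) :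
    MvPolynomial (Finset (Fin n)) R :=
  bind₁ (fun S => ∑ T : Finset (Fin n), C (actVec γ π (Pi.single T 1) S) * X T) P

/-- The orbit of a set of polynomials in the `a_S` under `SL₂(R)ⁿ ⋊ S_n`. -/
def orbit {R : Type*} [CommRing R] {n : ℕ} (E : Set (MvPolynomial (Finset (Fin n)) R)) :
    Set (MvPolynomial (Finset (Fin n)) R) :=
  {Q | ∃ γ : Fin n → Matrix.SpecialLinearGroup (Fin 2) R, ∃ π : Equiv.Perm (Fin n),
    ∃ P ∈ E, Q = actPoly γ π P}

/-- The set of common zeros of a set of polynomials in the `a_S`. -/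
def variety {R : Type*} [CommRing R] {n : ℕ} (E : Set (MvPolynomial (Finset (Fin n)) R)) :
    Set (Finset (Fin n) → R) :=
  {a | ∀ P ∈ E, eval a P = 0}

/-- The natural inclusion of `R[a_S : S ⊆ [m]]` into `R[a_S : S ⊆ [n]]` for `m ≤ n`. -/
def incl {R : Type*} [CommRing R] {m n : ℕ} (h : m ≤ n)
    (P : MvPolynomial (Finset (Fin m)) R) : MvPolynomial (Finset (Fin n)) R :=
  rename (fun S : Finset (Fin m) => S.map (Fin.castLEEmb h)) P

/-- The ideal `I_n` in `F[a_S : S ⊆ [n]]` generated by the homogeneous polynomials that vanish on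
the principal minor vectors of all `n × n` matrices with entries in the extension `K` of `F`. -/
def minorIdeal (F K : Type*) [Field F] [Field K] [Algebra F K] (n : ℕ) :
    Ideal (MvPolynomial (Finset (Fin n)) F) :=
  Ideal.span {P | (∃ d, P.IsHomogeneous d) ∧
    ∀ A : Matrix (Fin n) (Fin n) K, aeval (principalMinors A) P = 0}

/-- The variables `x_1, …, x_{2n+1}` with their usual numbering, and `x_{2n+2} = x_2`. -/
def xvar (R : Type*) [CommRing R] (n k : ℕ) : MvPolynomial (Fin (2 * n + 1)) R :=
  if k = 2 * n + 2 then X (Fin.ofNat (2 * n + 1) 1) else X (Fin.ofNat (2 * n + 1) (k - 1))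

/-- `f_{2n+1} = x_1 ∏_{j=1}^n (x_{2j+1} x_{2j+2} + 1) + ∏_{j=1}^n (x_{2j} x_{2j+1} + 1)`. -/
def fPoly (R : Type*) [CommRing R] (n : ℕ) : MvPolynomial (Fin (2 * n + 1)) R :=
  xvar R n 1 * ∏ j ∈ Finset.Icc 1 n, (xvar R n (2 * j + 1) * xvar R n (2 * j + 2) + 1) +
    ∏ j ∈ Finset.Icc 1 n, (xvar R n (2 * j) * xvar R n (2 * j + 1) + 1)

/-- The Rayleigh difference `Δ_{ij}(f)`. -/
def rayleigh {R : Type*} [CommRing R] {n : ℕ} (i j : Fin n) (f : MvPolynomial (Fin n) R) :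
    MvPolynomial (Fin n) R :=
  pderiv i f * pderiv j f - f * pderiv i (pderiv j f)

/-- Degree at most one in each variable. -/
def IsMultiaffine {R : Type*} [CommRing R] {n : ℕ} (g : MvPolynomial (Fin n) R) : Prop :=
  ∀ i, degreeOf i g ≤ 1

theorem actVec_eq_sum {R : Type*} [CommRing R] {n : ℕ}
    (γ : Fin n → Matrix.SpecialLinearGroup (Fin 2) R) (π : Equiv.Perm (Fin n))
    (a : Finset (Fin n) → R) (S : Finset (Fin n)) :
    actVec γ π a S = ∑ T : Finset (Fin n), actVec γ π (Pi.single T 1) S * a T := by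
  have h0 : ∀ b : Finset (Fin n) → R, rename π (multiaffinePoly b) =
      ∑ T : Finset (Fin n), C (b T) * rename π (∏ i ∈ Tᶜ, X i : MvPolynomial (Fin n) R) := by
    intro b; simp [multiaffinePoly]
  have h1 : ∀ b : Finset (Fin n) → R, actVec γ π b S =
      ∑ U : Finset (Fin n), (∑ T : Finset (Fin n), b T *
        coeffVec (rename π (∏ i ∈ Tᶜ, X i : MvPolynomial (Fin n) R)) U) *
        coeffVec ((∏ i ∈ Uᶜ, (C ((γ i).1 0 0) * X i + C ((γ i).1 0 1))) *
          ∏ i ∈ U, (C ((γ i).1 1 0) * X i + C ((γ i).1 1 1))) S := by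
    intro b
    simp only [actVec, moebius, h0, coeffVec, coeff_sum, coeff_C_mul]
  rw [h1 a]
  simp only [h1, Finset.sum_mul, Pi.single_apply, ite_mul, one_mul, zero_mul, Finset.sum_ite_eq',
    Finset.mem_univ, if_true]
  rw [Finset.sum_comm]
  refine Finset.sum_congr rfl fun T _ => Finset.sum_congr rfl fun U _ => ?_
  ring

/-- `actPoly γ π P` is the polynomial function `a ↦ P((γ, π) · a)`. -/
theorem eval_actPoly {R : Type*} [CommRing R] {n : ℕ}
    (γ : Fin n → Matrix.SpecialLinearGroup (Fin 2) R) (π : Equiv.Perm (Fin n))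
    (P : MvPolynomial (Finset (Fin n)) R) (a : Finset (Fin n) → R) :
    eval a (actPoly γ π P) = eval (actVec γ π a) P := by
  have h : actVec γ π a = fun S => eval a
      (∑ T : Finset (Fin n), C (actVec γ π (Pi.single T 1) S) * X T) := by
    funext S
    rw [actVec_eq_sum]; simp
  rw [actPoly, h]
  simp only [← coe_aeval_eq_eval, RingHom.coe_coe]
  exact aeval_bind₁ _ _ _

end PrincipalMinor

end

open MvPolynomial

noncomputable section

namespace PrincipalMinor

/-! The vectors `rowDet B C` are the coefficient vectors of the determinants det(diag(x) B + C).
Each `SL₂` factor replaces the two rows attached to a variable by linear combinations of them, so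
this class is stable under the group. It contains the principal minor vectors (B = 1), and it lies
in the variety of `minorIdeal`: for invertible B, `rowDet B C` is det B times the principal minor
vector of C B⁻¹, and singular B is reached by a polynomial argument over the infinite field
(`rowDet_mem_variety_minorIdeal`).

Membership. Fixing any one of the 2n+1 variables of the form f_{2n+1} at a pair (p, q) leaves a sum
of two products around a cycle through the other 2n variables. Such a sum is the determinant of a
cyclic bidiagonal matrix with bilinear entries, hence of a pencil of size 2n
(`exists_rowDet_cyclic`, `exists_det_eq_fForm`). So every translate of coeff(f_{2n+1}), restricted
to the subsets of [2n], is some `rowDet B C` (`exists_rowDet_eq_actVec_fPoly`), and equations in few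
variables that hold for all these vectors hold on the whole orbit.

Non-membership. For f = det(diag(x) + A) the Rayleigh difference is a product of two multiaffine
adjugate entries (`rayleigh_det_pencil`). A point of the variety of `minorIdeal` is a specialization
of the generic multiple of a generic minor vector; a valuation ring realizes the specialization and
Gauss's lemma carries the factorization to its residue field (`exists_rayleigh_eq_mul`). But
Δ₁₂(f_{2n+1}) is a product of primes that are the edges of an odd cycle on the variables. Adjacent
edges share a variable and must lie in different multiaffine factors, so a factorization would be a
proper 2-colouring of the edges of an odd cycle (`odd_cycle_not_mul`). -/

/-- The determinant of the matrix whose rows with index in `S` come from `C` and whose other rows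
come from `B`. -/
def rowDet {ι R : Type*} [Fintype ι] [DecidableEq ι] [CommRing R] (B C : Matrix ι ι R)
    (S : Finset ι) : R :=
  (Matrix.of fun i j => if i ∈ S then C i j else B i j).det

/-- The multihomogeneous form of a coefficient vector. -/
def homForm {ι R : Type*} [Fintype ι] [DecidableEq ι] [CommRing R] (a : Finset ι → R)
    (u v : ι → R) : R :=
  ∑ S : Finset ι, a S * ((∏ i ∈ Sᶜ, u i) * ∏ i ∈ S, v i)

/-! ### Determinants with mixed rows, cyclic matrices and bilinear pencils. -/

section Det

variable {ι R : Type*} [Fintype ι] [DecidableEq ι] [CommRing R]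

/-- Multilinearity in the rows: row i is a sum of u i • B i and v i • C i, and expanding chooses the
set S of rows taken from C. -/
theorem homForm_rowDet (B C : Matrix ι ι R) (u v : ι → R) :
    homForm (rowDet B C) u v =
      (Matrix.diagonal u * B + Matrix.diagonal v * C).det := by
  have h := (Matrix.detRowAlternating (R := R) (n := ι)).toMultilinearMap.map_add_univ
    (fun i => v i • C i) (fun i => u i • B i)
  have e1 : (Matrix.diagonal u * B + Matrix.diagonal v * C) =
      ((fun i => v i • C i) + (fun i => u i • B i) : ι → ι → R) := by
    ext i j
    simp [Matrix.add_apply, Matrix.diagonal_mul, add_comm]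
  rw [e1]
  refine Eq.trans ?_ h.symm
  refine Finset.sum_congr rfl fun S _ => ?_
  have e2 : S.piecewise (fun i => v i • C i) (fun i => u i • B i) =
      fun i => (if i ∈ S then v i else u i) •
        (fun j => if i ∈ S then C i j else B i j : ι → R) := by
    funext i
    by_cases hi : i ∈ S <;> simp [hi, Finset.piecewise]
  rw [e2, MultilinearMap.map_smul_univ, rowDet, smul_eq_mul, mul_comm]
  congr 1
  rw [← Finset.prod_mul_prod_compl S, mul_comm]
  congr 1
  · exact Finset.prod_congr rfl fun i hi => (if_pos hi).symm
  · exact Finset.prod_congr rfl fun i hi => (if_neg (Finset.mem_compl.1 hi)).symm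

theorem rowDet_eq_det (B C : Matrix ι ι R) (S : Finset ι) :
    rowDet B C S = (Matrix.diagonal (fun i => if i ∈ S then 0 else 1) * B +
      Matrix.diagonal (fun i => if i ∈ S then 1 else 0) * C).det := by
  rw [rowDet]
  congr 1
  ext i j
  by_cases h : i ∈ S <;> simp [Matrix.diagonal_mul, h]

theorem rowDet_mul (B C M : Matrix ι ι R) (S : Finset ι) :
    rowDet (B * M) (C * M) S = rowDet B C S * M.det := by
  simp only [rowDet_eq_det, ← Matrix.mul_assoc, ← Matrix.add_mul, Matrix.det_mul]

theorem rowDet_map {R' : Type*} [CommRing R'] (f : R →+* R') (B C : Matrix ι ι R) (S : Finset ι) :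
    rowDet (B.map f) (C.map f) S = f (rowDet B C S) := by
  rw [rowDet, rowDet, RingHom.map_det]
  congr 1
  ext i j
  by_cases h : i ∈ S <;> simp [h]

/-- This is `homForm` for B = 1 and C a cyclic permutation matrix. A mixed choice of rows takes row
i from C and row i + 1 from B for some i, and these rows coincide; only the two pure choices
survive. -/
theorem det_cyclic (m : ℕ) (U V : Fin (m + 1) → R) :
    (Matrix.of fun i j => (if j = i then U i else 0) + (if j = i + 1 then V i else 0) :
      Matrix (Fin (m + 1)) (Fin (m + 1)) R).det = ∏ i, U i + (-1) ^ m * ∏ i, V i := by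
  set B : Matrix (Fin (m + 1)) (Fin (m + 1)) R := 1 with hB
  set C : Matrix (Fin (m + 1)) (Fin (m + 1)) R := (finRotate (m + 1)).permMatrix R with hC
  have e : (Matrix.of fun i j => (if j = i then U i else 0) + (if j = i + 1 then V i else 0) :
      Matrix (Fin (m + 1)) (Fin (m + 1)) R) = Matrix.diagonal U * B + Matrix.diagonal V * C := by
    ext i j
    simp [hB, hC, Matrix.diagonal_mul, Equiv.Perm.permMatrix, PEquiv.toMatrix_apply,
      Matrix.diagonal_apply, eq_comm]
  rw [e, ← homForm_rowDet, homForm]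
  have h0 : ∀ S : Finset (Fin (m + 1)), S ≠ ∅ → S ≠ Finset.univ → rowDet B C S = 0 := by
    intro S hS hS'
    -- A nonempty set closed under i ↦ i + 1 is the whole cycle.
    obtain ⟨i, hi, hi'⟩ : ∃ i, i ∈ S ∧ i + 1 ∉ S := by
      by_contra! hcon
      obtain ⟨i, hi⟩ := Finset.nonempty_iff_ne_empty.2 hS
      apply hS'
      have : ∀ k : ℕ, i + (Fin.ofNat (m + 1) k) ∈ S := by
        intro k
        induction k with
        | zero => simpa using hi
        | succ k ih =>
          have := hcon _ ih
          convert this using 1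
          rw [add_assoc]
          congr 1
          ext; simp [Fin.val_add]
      ext j
      simp only [Finset.mem_univ, iff_true]
      have := this ((j - i : Fin (m + 1)) : ℕ)
      simpa using this
    have hne : i ≠ i + 1 := fun h => hi' (h ▸ hi)
    refine Matrix.det_zero_of_row_eq hne ?_
    funext j
    simp [hi, hi', hB, hC, Equiv.Perm.permMatrix, PEquiv.toMatrix_apply, Matrix.one_apply]
  have hne : (∅ : Finset (Fin (m + 1))) ≠ Finset.univ := Finset.univ_nonempty.ne_empty.symm
  rw [← Finset.sum_subset (Finset.subset_univ {∅, Finset.univ})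
    (fun S _ hS => by
      simp only [Finset.mem_insert, Finset.mem_singleton, not_or] at hS
      rw [h0 S hS.1 hS.2, zero_mul]), Finset.sum_pair hne]
  have h1 : rowDet B C ∅ = 1 := by
    rw [rowDet]
    convert Matrix.det_one (n := Fin (m + 1)) (R := R)
    ext i j; simp [hB]
  have h2 : rowDet B C Finset.univ = (-1) ^ m := by
    rw [rowDet]
    have : (Matrix.of fun i j => if i ∈ Finset.univ then C i j else B i j) = C := by
      ext i j; simp
    rw [this, hC, Matrix.det_permutation, sign_finRotate]
    simp
  rw [h1, h2]
  simp

/-- Block elimination gives the identity only after multiplication by det(diag d). Replacing d by X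
+ d over R[X] makes this factor monic, hence cancellable, and X = 0 returns the claim over any
commutative ring. -/
theorem det_fromBlocks_diagonal (d e : ι → R) (P Q : Matrix ι ι R) :
    (Matrix.fromBlocks (Matrix.diagonal d) P (-Matrix.diagonal e) Q).det =
      (Matrix.diagonal d * Q + Matrix.diagonal e * P).det := by
  have key : ∀ (A : Type _) [CommRing A] (d e : ι → A) (P Q : Matrix ι ι A),
      (Matrix.diagonal d).det *
        (Matrix.fromBlocks (Matrix.diagonal d) P (-Matrix.diagonal e) Q).det =
      (Matrix.diagonal d).det * (Matrix.diagonal d * Q + Matrix.diagonal e * P).det := by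
    intro A _ d e P Q
    have h1 : (Matrix.fromBlocks 1 0 (Matrix.diagonal e) (Matrix.diagonal d)) *
        (Matrix.fromBlocks (Matrix.diagonal d) P (-Matrix.diagonal e) Q) =
        Matrix.fromBlocks (Matrix.diagonal d) P 0
          (Matrix.diagonal d * Q + Matrix.diagonal e * P) := by
      rw [Matrix.fromBlocks_multiply]
      congr 1
      · simp
      · simp
      · simp [Matrix.diagonal_mul_diagonal, mul_comm]
      · exact add_comm _ _
    have h2 := congrArg Matrix.det h1
    rwa [Matrix.det_mul, Matrix.det_fromBlocks_zero₁₂, Matrix.det_fromBlocks_zero₂₁,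
      Matrix.det_one, one_mul] at h2
  let c : R →+* Polynomial R := Polynomial.C
  have h := key (Polynomial R) (fun i => Polynomial.X + c (d i)) (fun i => c (e i)) (P.map c) (Q.map c)
  have hm : ((Matrix.diagonal fun i => Polynomial.X + c (d i)).det).Monic := by
    rw [Matrix.det_diagonal]
    exact Polynomial.monic_prod_of_monic _ _ fun i _ => Polynomial.monic_X_add_C _
  have h' := congrArg (Polynomial.evalRingHom 0) (hm.isRegular.left h)
  rw [RingHom.map_det, RingHom.map_det] at h'
  convert h' using 2
  · ext (i | i) (j | j) <;> simp [Matrix.diagonal_apply, c] <;> split_ifs <;> simp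
  · ext i j
    simp [Matrix.diagonal_mul, c]

/-- Determinants of matrices whose entries are bilinear in a pair of row variables and a pair of
column variables have a representation in which every pair of variables occurs in one row. -/
theorem det_bilinear_eq (α β γ δ : Matrix ι ι R) (u v : ι ⊕ ι → R) :
    (Matrix.of fun i j => v (.inl i) * (v (.inr j) * α i j + u (.inr j) * β i j) +
        u (.inl i) * (v (.inr j) * γ i j + u (.inr j) * δ i j)).det =
      (Matrix.diagonal u * Matrix.fromBlocks 0 (-1) δ.transpose β.transpose +
        Matrix.diagonal v * Matrix.fromBlocks 1 0 γ.transpose α.transpose).det := by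
  rw [← Matrix.det_transpose (Matrix.diagonal u * _ + _)]
  have := det_fromBlocks_diagonal (fun i => v (.inl i)) (fun i => u (.inl i))
    (Matrix.of fun i j => v (.inr j) * γ i j + u (.inr j) * δ i j)
    (Matrix.of fun i j => v (.inr j) * α i j + u (.inr j) * β i j)
  -- In the block matrix each pair of variables occupies one column; the transpose turns these
  -- columns into the rows of a pencil.
  convert this.symm using 2
  · ext i j
    simp [Matrix.diagonal_mul]
  · ext (i | i) (j | j) <;> simp [Matrix.diagonal_mul, Matrix.diagonal_apply, Matrix.one_apply]
    all_goals first
      | (by_cases h : i = j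
         · subst h; simp
         · simp [h, Ne.symm h])
      | ring

end Det

theorem exists_rowDet_cyclic {R : Type*} [CommRing R] (m : ℕ)
    (α β γ δ α' β' γ' δ' : Fin (m + 1) → R) :
    ∃ B C : Matrix (Fin (m + 1) ⊕ Fin (m + 1)) (Fin (m + 1) ⊕ Fin (m + 1)) R, ∀ u v,
      (Matrix.diagonal u * B + Matrix.diagonal v * C).det =
      ∏ i, (v (.inl i) * (v (.inr i) * α i + u (.inr i) * β i) +
        u (.inl i) * (v (.inr i) * γ i + u (.inr i) * δ i)) +
      ∏ i, (v (.inl i) * (v (.inr (i + 1)) * α' i + u (.inr (i + 1)) * β' i) +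
        u (.inl i) * (v (.inr (i + 1)) * γ' i + u (.inr (i + 1)) * δ' i)) := by
  -- One entry of the cyclic matrix carries the sign that cancels the (-1)^m of `det_cyclic`.
  let s : Fin (m + 1) → R := fun i => if i = 0 then (-1) ^ m else 1
  let N : (Fin (m + 1) → R) → (Fin (m + 1) → R) → Matrix (Fin (m + 1)) (Fin (m + 1)) R :=
    fun a a' => Matrix.of fun i j => (if j = i then a i else 0) + (if j = i + 1 then s i * a' i else 0)
  refine ⟨_, _, fun u v => (det_bilinear_eq (N α α') (N β β') (N γ γ') (N δ δ') u v).symm.trans ?_⟩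
  have hs : (-1) ^ m * ∏ i, s i = 1 := by
    simp only [s, Finset.prod_ite_eq', Finset.mem_univ, if_true]
    rw [← mul_pow]; simp
  have e := det_cyclic m (fun i => (v (.inl i) * (v (.inr i) * α i + u (.inr i) * β i) +
        u (.inl i) * (v (.inr i) * γ i + u (.inr i) * δ i)))
      (fun i => s i * (v (.inl i) * (v (.inr (i + 1)) * α' i + u (.inr (i + 1)) * β' i) +
        u (.inl i) * (v (.inr (i + 1)) * γ' i + u (.inr (i + 1)) * δ' i)))
  rw [Finset.prod_mul_distrib, ← mul_assoc, hs, one_mul] at e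
  rw [← e]
  congr 1
  ext i j
  simp only [N, Matrix.of_apply]
  by_cases h1 : j = i
  · subst h1
    by_cases h2 : j = j + 1
    · rw [← h2]; simp; ring
    · simp [h2]
  · by_cases h2 : j = i + 1
    · subst h2; simp [h1]; ring
    · simp [h1, h2]

/-! ### Rayleigh differences of det(diag(x) + A). -/

section Rayleigh
variable {R : Type*} [CommRing R] {n : ℕ}

/-- The matrix `diag(x) + A`. -/
def pencil (A : Matrix (Fin n) (Fin n) R) : Matrix (Fin n) (Fin n) (MvPolynomial (Fin n) R) :=
  Matrix.diagonal X + A.map C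

theorem derivation_prod_eq_zero {ι A : Type*} [CommRing A] [Algebra R A] (D : Derivation R A A)
    (s : Finset ι) (f : ι → A) (h : ∀ i ∈ s, D (f i) = 0) : D (∏ i ∈ s, f i) = 0 := by
  classical
  induction s using Finset.induction_on with
  | empty => simp
  | insert a s ha ih =>
    rw [Finset.prod_insert ha, D.leibniz, h a (by simp), ih fun i hi => h i (by simp [hi])]
    simp

theorem derivation_det_eq_zero {ι A : Type*} [Fintype ι] [DecidableEq ι] [CommRing A] [Algebra R A]
    (D : Derivation R A A) (M : Matrix ι ι A) (h : ∀ i j, D (M i j) = 0) : D M.det = 0 := by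
  rw [Matrix.det_apply, map_sum]
  refine Finset.sum_eq_zero fun σ _ => ?_
  rw [Units.smul_def, map_zsmul, derivation_prod_eq_zero D _ _ fun i _ => h _ _, smul_zero]

theorem pderiv_pencil (A : Matrix (Fin n) (Fin n) R) (k i j : Fin n) :
    pderiv k (pencil A i j) = if i = k ∧ j = k then 1 else 0 := by
  by_cases hij : i = j
  · subst hij
    by_cases h : i = k
    · subst h; simp [pencil]
    · simp [pencil, h, pderiv_X_of_ne h]
  · have : ¬ (i = k ∧ j = k) := fun h => hij (h.1.trans h.2.symm)
    simp [pencil, hij, this]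

/-- The variable x_k occurs only in row k, which splits as x_k e_k plus a constant row. -/
theorem pderiv_det_pencil (A : Matrix (Fin n) (Fin n) R) (k : Fin n) :
    pderiv k (pencil A).det = (pencil A).adjugate k k := by
  have h1 : pencil A = (pencil A).updateRow k
      ((X k : MvPolynomial (Fin n) R) • (Pi.single k 1) + fun j => C (A k j)) := by
    ext i j : 2
    by_cases h : i = k
    · subst h
      by_cases hj : j = i
      · subst hj; simp [pencil]
      · simp [pencil, hj, Ne.symm hj]
    · simp [h]
  have hz : ∀ w : Fin n → MvPolynomial (Fin n) R, (∀ j, pderiv k (w j) = 0) →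
      pderiv k ((pencil A).updateRow k w).det = 0 := by
    intro w hw
    refine derivation_det_eq_zero _ _ fun i j => ?_
    by_cases h : i = k
    · subst h; simp [hw]
    · rw [Matrix.updateRow_ne h, pderiv_pencil]; simp [h]
  conv_lhs => rw [h1]
  rw [Matrix.det_updateRow_add, Matrix.det_updateRow_smul, map_add, pderiv_mul, pderiv_X_self,
    hz _ fun j => pderiv_C, hz _ (fun j => ?_), Matrix.adjugate_apply]
  · ring
  · by_cases hj : j = k
    · subst hj; simp
    · simp [hj]

/-- A form of the Jacobi–Dodgson identity. Applying ∂_i to M · adj M = det M · 1 and pairing column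
j with row j of adj M gives it without inverting det M, since ∂_i M is the matrix unit at (i, i). -/
theorem rayleigh_det_pencil (A : Matrix (Fin n) (Fin n) R) (i j : Fin n) :
    rayleigh i j (pencil A).det = (pencil A).adjugate i j * (pencil A).adjugate j i := by
  set M := pencil A with hM
  have hadj : M * M.adjugate = M.det • 1 := M.mul_adjugate
  have hd : ∀ k l, pderiv i ((M * M.adjugate) k l) =
      (if k = i then M.adjugate i l else 0) + ∑ p, M k p * pderiv i (M.adjugate p l) := by
    intro k l
    simp only [Matrix.mul_apply, map_sum, pderiv_mul, Finset.sum_add_distrib, hM, pderiv_pencil]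
    congr 1
    by_cases hk : k = i <;> simp [hk]
  have hsum : ∑ k, M.adjugate j k * pderiv i ((M * M.adjugate) k j) =
      M.adjugate j i * M.adjugate i j + M.det * pderiv i (M.adjugate j j) := by
    simp only [hd, mul_add, Finset.sum_add_distrib]
    congr 1
    · simp
    · simp only [Finset.mul_sum]
      rw [Finset.sum_comm]
      simp only [← mul_assoc, ← Finset.sum_mul, ← Matrix.mul_apply, M.adjugate_mul,
        Matrix.smul_apply, Matrix.one_apply]
      simp
  have hsum' : ∑ k, M.adjugate j k * pderiv i ((M * M.adjugate) k j) =
      M.adjugate j j * pderiv i M.det := by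
    rw [hadj, Finset.sum_eq_single j]
    · simp
    · intro k _ hk; simp [hk]
    · simp
  rw [hsum'] at hsum
  rw [rayleigh, hM, pderiv_det_pencil A j, ← hM]
  linear_combination hsum

/-- Every term of the determinant takes one entry per row, and x_k may occur only in row k. -/
theorem isMultiaffine_det {M : Matrix (Fin n) (Fin n) (MvPolynomial (Fin n) R)}
    (h : ∀ k i j, degreeOf k (M i j) ≤ if i = k then 1 else 0) : IsMultiaffine M.det := by
  intro k
  rw [Matrix.det_apply']
  refine (degreeOf_sum_le _ _ _).trans (Finset.sup_le fun σ _ => ?_)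
  rw [← map_intCast (C : R →+* MvPolynomial (Fin n) R)]
  refine (degreeOf_C_mul_le _ _ _).trans ((degreeOf_prod_le _ _ _).trans ?_)
  rw [← Equiv.sum_comp σ.symm]
  refine (Finset.sum_le_sum fun i _ => h k _ _).trans ?_
  simp

theorem isMultiaffine_adjugate_pencil (A : Matrix (Fin n) (Fin n) R) (i j : Fin n) :
    IsMultiaffine ((pencil A).adjugate i j) := by
  rcases subsingleton_or_nontrivial R with _ | _
  · intro k
    simp [Subsingleton.elim ((pencil A).adjugate i j) 0]
  rw [Matrix.adjugate_apply]
  refine isMultiaffine_det fun k p q => ?_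
  by_cases hp : p = j
  · subst hp
    rw [Matrix.updateRow_self]
    by_cases hq : q = i
    · subst hq; simp
    · simp [hq]
  · rw [Matrix.updateRow_ne hp]
    by_cases hpq : p = q
    · subst hpq
      rw [pencil, Matrix.add_apply, Matrix.diagonal_apply_eq, Matrix.map_apply]
      refine (degreeOf_add_le _ _ _).trans ?_
      simp [degreeOf_X, eq_comm]
    · simp [pencil, hpq]

end Rayleigh

/-! ### The odd cycle of primes. -/

section Prime
variable {σ k : Type*} [Field k]

theorem prime_X_mul_X_add_one {a b : σ} (hab : a ≠ b) :
    Prime (X a * X b + 1 : MvPolynomial σ k) := by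
  classical
  refine Irreducible.prime (irreducible_mul_X_add _ _ _ (X_ne_zero _) ?_ ?_ isRelPrime_one_right)
  · simpa [vars_X] using hab.symm
  · simp

theorem prime_X_sub_X {a b : σ} (hab : a ≠ b) : Prime (X a - X b : MvPolynomial σ k) := by
  classical
  have := irreducible_mul_X_add (1 : MvPolynomial σ k) (-X b) a one_ne_zero (by simp)
    (by simpa [vars_neg, vars_X] using hab) isRelPrime_one_left
  rw [one_mul, ← sub_eq_add_neg] at this
  exact this.prime

theorem degreeOf_X_mul_X_add_one [DecidableEq σ] {a b : σ} (hab : a ≠ b) (i : σ) :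
    degreeOf i (X a * X b + 1 : MvPolynomial σ k) = if i = a ∨ i = b then 1 else 0 := by
  have h1 : degreeOf i (X a * X b : MvPolynomial σ k) = if i = a ∨ i = b then 1 else 0 := by
    rw [degreeOf_mul_eq (X_ne_zero _) (X_ne_zero _), degreeOf_X, degreeOf_X]
    by_cases h : i = a
    · subst h; simp [hab]
    · simp [h]
  split_ifs at h1 ⊢ with h
  · rw [← h1]
    refine degreeOf_add_eq_of_degreeOf_lt ?_
    rw [h1]; simp
  · have := degreeOf_add_le i (X a * X b : MvPolynomial σ k) 1
    rw [h1] at this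
    simpa using this

theorem degreeOf_X_sub_X [DecidableEq σ] {a b : σ} (hab : a ≠ b) (i : σ) :
    degreeOf i (X a - X b : MvPolynomial σ k) = if i = a ∨ i = b then 1 else 0 := by
  have hn : degreeOf i (-X b : MvPolynomial σ k) = if i = b then 1 else 0 := by
    have : (-X b : MvPolynomial σ k) = C (-1) * X b := by simp
    rw [this, degreeOf_mul_eq (by simp) (X_ne_zero _), degreeOf_C, degreeOf_X, zero_add]
  rw [sub_eq_add_neg]
  by_cases h : i = a
  · subst h
    simp only [true_or, if_true]
    rw [degreeOf_add_eq_of_degreeOf_lt, degreeOf_X, if_pos rfl]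
    rw [hn, degreeOf_X, if_pos rfl, if_neg hab]; exact one_pos
  · by_cases h' : i = b
    · subst h'
      rw [add_comm, degreeOf_add_eq_of_degreeOf_lt, hn] <;> simp [hn, degreeOf_X, h]
    · have := degreeOf_add_le i (X a : MvPolynomial σ k) (-X b)
      rw [hn, degreeOf_X, if_neg h, if_neg h'] at this
      simpa [h, h'] using this

/-- Two primes that share a variable and differ in another one cannot both divide a polynomial that
is affine in the shared variable. -/
theorem false_of_two_primes_dvd {g p q : MvPolynomial σ k} (hg : g ≠ 0) (hp : Prime p)
    (hpg : p ∣ g) (hqg : q ∣ g) {i j : σ} (hgi : degreeOf i g ≤ 1) (hpi : 1 ≤ degreeOf i p)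
    (hqi : 1 ≤ degreeOf i q) (hpj : 1 ≤ degreeOf j p) (hqj : degreeOf j q = 0) : False := by
  obtain ⟨r, rfl⟩ := hqg
  have hq0 := left_ne_zero_of_mul hg
  have hr0 := right_ne_zero_of_mul hg
  -- If p divided q, then q would involve the variable j; otherwise p q divides g, which then has
  -- degree at least 2 in the variable i.
  rcases hp.dvd_or_dvd hpg with ⟨s, rfl⟩ | ⟨s, rfl⟩
  · rw [degreeOf_mul_eq hp.ne_zero (right_ne_zero_of_mul hq0)] at hqj
    omega
  · rw [degreeOf_mul_eq hq0 hr0, degreeOf_mul_eq hp.ne_zero (right_ne_zero_of_mul hr0)] at hgi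
    omega

/-- The 2m path edges and the closing edge w 0 – w (2m) form a cycle of odd length 2m + 1. Each
prime divides g or h, and adjacent ones never divide the same factor, so the factors alternate along
the path and clash at the closing edge. -/
theorem odd_cycle_not_mul {w : ℕ → σ} {m : ℕ} (hm : 1 ≤ m) (hw : Set.InjOn w (Set.Iic (2 * m)))
    {g h : MvPolynomial σ k} (hg : ∀ i, degreeOf i g ≤ 1) (hh : ∀ i, degreeOf i h ≤ 1)
    (e : (X (w 0) - X (w (2 * m))) * ∏ i ∈ Finset.range (2 * m), (X (w i) * X (w (i + 1)) + 1) =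
      g * h) : False := by
  classical
  have hne : ∀ {i j : ℕ}, i ≤ 2 * m → j ≤ 2 * m → i ≠ j → w i ≠ w j :=
    fun hi hj hij he => hij (hw hi hj he)
  have hpd : Prime (X (w 0) - X (w (2 * m)) : MvPolynomial σ k) :=
    prime_X_sub_X (hne (by omega) (by omega) (by omega))
  have hpe : ∀ i < 2 * m, Prime (X (w i) * X (w (i + 1)) + 1 : MvPolynomial σ k) := fun i hi =>
    prime_X_mul_X_add_one (hne (by omega) (by omega) (by omega))
  have he0 : g * h ≠ 0 := by
    rw [← e]
    exact mul_ne_zero hpd.ne_zero (Finset.prod_ne_zero_iff.2 fun i hi =>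
      (hpe i (Finset.mem_range.1 hi)).ne_zero)
  wlog hdg : (X (w 0) - X (w (2 * m)) : MvPolynomial σ k) ∣ g generalizing g h
  · rw [mul_comm] at he0
    refine this hh hg (e.trans (mul_comm _ _)) he0 ?_
    exact (hpd.dvd_or_dvd (e ▸ dvd_mul_right _ _)).resolve_left hdg
  have hg0 := left_ne_zero_of_mul he0
  have hh0 := right_ne_zero_of_mul he0
  have hdvd : ∀ i < 2 * m, (X (w i) * X (w (i + 1)) + 1 : MvPolynomial σ k) ∣ g ∨
      (X (w i) * X (w (i + 1)) + 1 : MvPolynomial σ k) ∣ h := fun i hi =>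
    (hpe i hi).dvd_or_dvd (e ▸ Dvd.dvd.mul_left (Finset.dvd_prod_of_mem _ (Finset.mem_range.2 hi)) _)
  have hdeg : ∀ i < 2 * m, ∀ j ≤ 2 * m,
      degreeOf (w j) (X (w i) * X (w (i + 1)) + 1 : MvPolynomial σ k) =
        if j = i ∨ j = i + 1 then 1 else 0 := by
    intro i hi j hj
    rw [degreeOf_X_mul_X_add_one (hne (by omega) (by omega) (by omega))]
    have h1 : w j = w i ↔ j = i := ⟨fun h => hw hj (show i ≤ 2 * m by omega) h, fun h => h ▸ rfl⟩
    have h2 : w j = w (i + 1) ↔ j = i + 1 :=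
      ⟨fun h => hw hj (show i + 1 ≤ 2 * m by omega) h, fun h => h ▸ rfl⟩
    simp only [h1, h2]
  have hdegd : ∀ j ≤ 2 * m, degreeOf (w j) (X (w 0) - X (w (2 * m)) : MvPolynomial σ k) =
        if j = 0 ∨ j = 2 * m then 1 else 0 := by
    intro j hj
    rw [degreeOf_X_sub_X (hne (by omega) (by omega) (by omega))]
    have h1 : w j = w 0 ↔ j = 0 := ⟨fun h => hw hj (show 0 ≤ 2 * m by omega) h, fun h => h ▸ rfl⟩
    have h2 : w j = w (2 * m) ↔ j = 2 * m :=
      ⟨fun h => hw hj (show 2 * m ≤ 2 * m by omega) h, fun h => h ▸ rfl⟩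
    simp only [h1, h2]
  have step : ∀ i, i + 1 < 2 * m → ∀ f : MvPolynomial σ k, f ≠ 0 → (∀ i, degreeOf i f ≤ 1) →
      (X (w i) * X (w (i + 1)) + 1 : MvPolynomial σ k) ∣ f →
      (X (w (i + 1)) * X (w (i + 1 + 1)) + 1 : MvPolynomial σ k) ∣ f → False := by
    intro i hi f hf0 hf h1 h2
    refine false_of_two_primes_dvd (i := w (i + 1)) (j := w i) hf0 (hpe i (by omega)) h1 h2 (hf _)
      ?_ ?_ ?_ ?_
    · rw [hdeg i (by omega) _ (by omega)]; simp
    · rw [hdeg (i + 1) (by omega) _ (by omega)]; simp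
    · rw [hdeg i (by omega) _ (by omega)]; simp
    · rw [hdeg (i + 1) (by omega) _ (by omega), if_neg (by omega)]
  -- With the closing edge in g, even-numbered edges are forced into h and odd-numbered ones into g.
  have main : ∀ j < m, (X (w (2 * j)) * X (w (2 * j + 1)) + 1 : MvPolynomial σ k) ∣ h ∧
      (X (w (2 * j + 1)) * X (w (2 * j + 1 + 1)) + 1 : MvPolynomial σ k) ∣ g := by
    intro j hj
    have hnext : (X (w (2 * j)) * X (w (2 * j + 1)) + 1 : MvPolynomial σ k) ∣ h →
        (X (w (2 * j + 1)) * X (w (2 * j + 1 + 1)) + 1 : MvPolynomial σ k) ∣ g := fun hd =>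
      (hdvd (2 * j + 1) (by omega)).resolve_right fun hd' =>
        step (2 * j) (by omega) h hh0 hh hd hd'
    suffices hs : (X (w (2 * j)) * X (w (2 * j + 1)) + 1 : MvPolynomial σ k) ∣ h from
      ⟨hs, hnext hs⟩
    clear hnext
    induction j with
    | zero =>
      refine (hdvd 0 (by omega)).resolve_left fun hd => ?_
      refine false_of_two_primes_dvd (i := w 0) (j := w 1) hg0 (hpe 0 (by omega)) hd hdg (hg _)
        ?_ ?_ ?_ ?_
      · rw [hdeg 0 (by omega) _ (by omega)]; simp
      · rw [hdegd _ (by omega)]; simp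
      · rw [hdeg 0 (by omega) _ (by omega)]; simp
      · rw [hdegd _ (by omega), if_neg (by omega)]
    | succ j ih =>
      have h1 := ih (by omega)
      have h2 := (hdvd (2 * j + 1) (by omega)).resolve_right fun hd' =>
        step (2 * j) (by omega) h hh0 hh h1 hd'
      exact (hdvd (2 * (j + 1)) (by omega)).resolve_left fun hd' =>
        step (2 * j + 1) (by omega) g hg0 hg h2 hd'
  -- The last edge has the odd number 2m - 1, so it divides g together with the closing edge, which
  -- it meets at w (2m).
  have hl := (main (m - 1) (by omega)).2
  have e1 : 2 * (m - 1) + 1 + 1 = 2 * m := by omega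
  rw [show 2 * (m - 1) + 1 = 2 * m - 1 by omega] at hl
  have hdl := fun j hj => hdeg (2 * m - 1) (by omega) j hj
  refine false_of_two_primes_dvd (i := w (2 * m)) (j := w (2 * m - 1)) hg0 (hpe (2 * m - 1) (by omega))
    hl hdg (hg _) ?_ ?_ ?_ ?_
  · rw [hdl _ (by omega), if_pos (by omega)]
  · rw [hdegd _ (by omega)]; simp
  · rw [hdl _ (by omega), if_pos (by omega)]
  · rw [hdegd _ (by omega), if_neg (by omega)]

end Prime

/-! ### Multihomogeneous forms and the group action on coefficient vectors. -/

section HomForm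
variable {ι R : Type*} [Fintype ι] [DecidableEq ι] [CommRing R]

theorem prod_compl_mul_prod_eq (S : Finset ι) (u v : ι → R) :
    (∏ i ∈ Sᶜ, u i) * ∏ i ∈ S, v i = ∏ i, if i ∈ S then v i else u i := by
  rw [← Finset.prod_mul_prod_compl S, mul_comm]
  congr 1
  · exact Finset.prod_congr rfl fun i hi => (if_pos hi).symm
  · exact Finset.prod_congr rfl fun i hi => (if_neg (Finset.mem_compl.1 hi)).symm

theorem prod_add_univ (u v : ι → R) :
    ∏ i, (u i + v i) = ∑ S : Finset ι, ∏ i, if i ∈ S then u i else v i := by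
  rw [Finset.prod_add, Finset.powerset_univ]
  refine Finset.sum_congr rfl fun S _ => ?_
  rw [← prod_compl_mul_prod_eq, mul_comm, Finset.compl_eq_univ_sdiff]

theorem homForm_map_symm {κ : Type*} [Fintype κ] [DecidableEq κ] (e : ι ≃ κ) (a : Finset ι → R)
    (u v : κ → R) :
    homForm (fun T : Finset κ => a (T.map e.symm.toEmbedding)) u v = homForm a (u ∘ e) (v ∘ e) := by
  refine Fintype.sum_equiv e.symm.finsetCongr _ _ fun T => ?_
  rw [prod_compl_mul_prod_eq, prod_compl_mul_prod_eq]
  congr 1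
  exact Fintype.prod_equiv e.symm _ _ fun i => by simp

theorem homForm_add (a b : Finset ι → R) (u v : ι → R) :
    homForm (a + b) u v = homForm a u v + homForm b u v := by
  simp [homForm, add_mul, Finset.sum_add_distrib]

theorem homForm_sum {κ : Type*} (s : Finset κ) (a : κ → Finset ι → R) (u v : ι → R) :
    homForm (∑ k ∈ s, a k) u v = ∑ k ∈ s, homForm (a k) u v := by
  simp only [homForm, Finset.sum_apply, Finset.sum_mul]
  exact Finset.sum_comm

theorem homForm_single (T : Finset ι) (u v : ι → R) :
    homForm (Pi.single T 1) u v = ∏ i, if i ∈ T then v i else u i := by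
  rw [← prod_compl_mul_prod_eq, homForm, Finset.sum_eq_single T]
  · simp
  · intro S _ hS; simp [hS]
  · simp

end HomForm

section CoeffVec
variable {R : Type*} [CommRing R] {n : ℕ}

theorem coeffVec_sum {κ : Type*} (s : Finset κ) (f : κ → MvPolynomial (Fin n) R) :
    coeffVec (∑ k ∈ s, f k) = ∑ k ∈ s, coeffVec (f k) := by
  funext S; simp [coeffVec, coeff_sum]

theorem coeffVec_prod_X (T : Finset (Fin n)) :
    coeffVec (∏ i ∈ Tᶜ, X i : MvPolynomial (Fin n) R) = Pi.single T 1 := by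
  funext S
  have h : (∏ i ∈ Tᶜ, X i : MvPolynomial (Fin n) R) =
      monomial (∑ i ∈ Tᶜ, Finsupp.single i 1) 1 := by
    rw [monomial_sum_one]
    rfl
  have hs : ∀ U : Finset (Fin n), ∀ i,
      (∑ j ∈ Uᶜ, Finsupp.single j 1 : Fin n →₀ ℕ) i = if i ∈ U then 0 else 1 := by
    intro U i
    simp [Finsupp.finsetSum_apply, Finsupp.single_apply]
  rw [coeffVec, h, coeff_monomial]
  by_cases hST : S = T
  · subst hST; simp
  · rw [if_neg, Pi.single_eq_of_ne hST]
    intro he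
    apply hST
    ext i
    have := DFunLike.congr_fun he i
    rw [hs, hs] at this
    by_cases h1 : i ∈ S <;> by_cases h2 : i ∈ T <;> simp_all

theorem coeffVec_C_mul (c : R) (f : MvPolynomial (Fin n) R) :
    coeffVec (C c * f) = c • coeffVec f := by
  funext S; simp [coeffVec]

theorem coeffVec_multiaffinePoly (a : Finset (Fin n) → R) : coeffVec (multiaffinePoly a) = a := by
  rw [multiaffinePoly, coeffVec_sum]
  simp only [coeffVec_C_mul, coeffVec_prod_X]
  funext S
  simp [Finset.sum_apply, Pi.single_apply]

theorem coeffVec_prod_linear (p q : Fin n → R) (S : Finset (Fin n)) :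
    coeffVec (∏ i, (C (p i) * X i + C (q i))) S = ∏ i, if i ∈ S then q i else p i := by
  have : (∏ i, (C (p i) * X i + C (q i)) : MvPolynomial (Fin n) R) =
      multiaffinePoly fun S => ∏ i, if i ∈ S then q i else p i := by
    simp_rw [add_comm (C (p _) * X _)]
    rw [prod_add_univ, multiaffinePoly]
    refine Finset.sum_congr rfl fun T _ => ?_
    rw [← prod_compl_mul_prod_eq, ← prod_compl_mul_prod_eq, Finset.prod_mul_distrib]
    simp only [map_mul, map_prod]
    ring
  rw [this, coeffVec_multiaffinePoly]

theorem rename_multiaffinePoly (π : Equiv.Perm (Fin n)) (a : Finset (Fin n) → R) :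
    rename π (multiaffinePoly a) =
      multiaffinePoly fun T : Finset (Fin n) => a (T.map π.symm.toEmbedding) := by
  simp only [multiaffinePoly, map_sum, map_mul, rename_C, map_prod, rename_X]
  refine Fintype.sum_equiv π.finsetCongr _ _ fun T => ?_
  have h1 : ((π.finsetCongr T).map π.symm.toEmbedding) = T := by
    ext i; simp
  rw [h1]
  congr 1
  refine Finset.prod_bij (fun i _ => π i) ?_ ?_ ?_ ?_
  · intro i hi; simpa using hi
  · intro i _ j _ h; exact π.injective h
  · intro i hi
    exact ⟨π.symm i, by simpa [Finset.mem_map_equiv] using hi, by simp⟩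
  · intro i _; rfl

/-- Extracting a coefficient of a product of linear factors picks, at each position, the first
column of γ outside S and the second column inside S. Thus the entries of the translate are values
of the form of a. -/
theorem actVec_eq_homForm (γ : Fin n → Matrix.SpecialLinearGroup (Fin 2) R)
    (π : Equiv.Perm (Fin n)) (a : Finset (Fin n) → R) (S : Finset (Fin n)) :
    actVec γ π a S = homForm a
      (fun i => if π i ∈ S then (γ (π i)).1 0 1 else (γ (π i)).1 0 0)
      (fun i => if π i ∈ S then (γ (π i)).1 1 1 else (γ (π i)).1 1 0) := by
  refine Eq.trans ?_ (homForm_map_symm π a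
    (fun i => if i ∈ S then (γ i).1 0 1 else (γ i).1 0 0)
    (fun i => if i ∈ S then (γ i).1 1 1 else (γ i).1 1 0))
  rw [actVec, rename_multiaffinePoly, moebius, coeffVec_multiaffinePoly, coeffVec_sum,
    Finset.sum_apply, homForm]
  refine Finset.sum_congr rfl fun T _ => ?_
  rw [coeffVec_C_mul, Pi.smul_apply, smul_eq_mul]
  congr 1
  rw [prod_compl_mul_prod_eq, prod_compl_mul_prod_eq]
  have : (∏ i, if i ∈ T then C ((γ i).1 1 0) * X i + C ((γ i).1 1 1)
      else C ((γ i).1 0 0) * X i + C ((γ i).1 0 1) : MvPolynomial (Fin n) R) =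
      ∏ i, (C (if i ∈ T then (γ i).1 1 0 else (γ i).1 0 0) * X i +
        C (if i ∈ T then (γ i).1 1 1 else (γ i).1 0 1)) :=
    Finset.prod_congr rfl fun i _ => by by_cases h : i ∈ T <;> simp [h]
  rw [this, coeffVec_prod_linear]
  refine Finset.prod_congr rfl fun i _ => ?_
  by_cases h : i ∈ T <;> by_cases h' : i ∈ S <;> simp [h, h']

end CoeffVec

/-! ### The polynomial f_{2n+1} and its coefficients. -/

section FPoly

/-- The position of the variable `x_{2j+2}`, for `j` counted from zero. -/
def evenVar {n : ℕ} (j : Fin n) : Fin (2 * n + 1) := ⟨2 * j + 1, by omega⟩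

/-- The position of the variable `x_{2j+3}`, for `j` counted from zero. -/
def oddVar {n : ℕ} (j : Fin n) : Fin (2 * n + 1) := ⟨2 * j + 2, by omega⟩

variable {n : ℕ}

theorem evenVar_injective : Function.Injective (evenVar (n := n)) := fun i j h => by
  have := congrArg Fin.val h
  simp only [evenVar] at this
  ext; omega

theorem oddVar_injective : Function.Injective (oddVar (n := n)) := fun i j h => by
  have := congrArg Fin.val h
  simp only [oddVar] at this
  ext; omega

@[simp] theorem evenVar_inj {i j : Fin n} : evenVar i = evenVar j ↔ i = j :=
  evenVar_injective.eq_iff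

@[simp] theorem oddVar_inj {i j : Fin n} : oddVar i = oddVar j ↔ i = j :=
  oddVar_injective.eq_iff

@[simp] theorem evenVar_ne_oddVar (i j : Fin n) : evenVar i ≠ oddVar j := fun h => by
  have := congrArg Fin.val h
  simp only [evenVar, oddVar] at this
  omega

@[simp] theorem oddVar_ne_evenVar (i j : Fin n) : oddVar i ≠ evenVar j :=
  (evenVar_ne_oddVar j i).symm

@[simp] theorem evenVar_ne_zero (i : Fin n) : evenVar i ≠ 0 := fun h => by
  have := congrArg Fin.val h
  simp [evenVar] at this

@[simp] theorem oddVar_ne_zero (i : Fin n) : oddVar i ≠ 0 := fun h => by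
  have := congrArg Fin.val h
  simp [oddVar] at this

@[simp] theorem zero_ne_evenVar (i : Fin n) : 0 ≠ evenVar i := (evenVar_ne_zero i).symm

@[simp] theorem zero_ne_oddVar (i : Fin n) : 0 ≠ oddVar i := (oddVar_ne_zero i).symm

theorem eq_zero_or_oddVar_or_evenVar (k : Fin (2 * n + 1)) :
    k = 0 ∨ (∃ j : Fin n, k = oddVar j) ∨ ∃ j : Fin n, k = evenVar j := by
  rcases Nat.even_or_odd' k.val with ⟨c, hc | hc⟩
  · rcases Nat.eq_zero_or_pos c with h0 | h0
    · left; ext; simp [hc, h0]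
    · right; left
      exact ⟨⟨c - 1, by omega⟩, by ext; simp [oddVar]; omega⟩
  · right; right
    exact ⟨⟨c, by omega⟩, by ext; simp [evenVar]; omega⟩

theorem prod_univ_odd_even {A : Type*} [CommRing A] (g : Fin (2 * n + 1) → A) :
    ∏ i, g i = g 0 * ((∏ j, g (oddVar j)) * ∏ j, g (evenVar j)) := by
  have key : ∀ (G : ℕ → A) (n : ℕ), ∏ i ∈ Finset.range (2 * n + 1), G i =
      G 0 * ((∏ j ∈ Finset.range n, G (2 * j + 2)) * ∏ j ∈ Finset.range n, G (2 * j + 1)) := by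
    intro G n
    induction n with
    | zero => simp
    | succ n ih =>
      rw [show 2 * (n + 1) + 1 = 2 * n + 1 + 1 + 1 by ring, Finset.prod_range_succ,
        Finset.prod_range_succ, ih, Finset.prod_range_succ, Finset.prod_range_succ]
      ring
  have h := key (fun k => g (Fin.ofNat (2 * n + 1) k)) n
  rw [Finset.prod_range, Finset.prod_range, Finset.prod_range] at h
  have e1 : ∀ j : Fin n, Fin.ofNat (2 * n + 1) (2 * j + 2) = oddVar j := fun j => by
    ext; simp only [Fin.val_ofNat, oddVar]; exact Nat.mod_eq_of_lt (by omega)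
  have e2 : ∀ j : Fin n, Fin.ofNat (2 * n + 1) (2 * j + 1) = evenVar j := fun j => by
    ext; simp only [Fin.val_ofNat, evenVar]; exact Nat.mod_eq_of_lt (by omega)
  simp only [e1, e2] at h
  simpa using h

/-- The convention x_{2n+2} = x_2 becomes addition modulo m + 1 in the index of `evenVar`. -/
theorem fPoly_eq {R : Type*} [CommRing R] (m : ℕ) : fPoly R (m + 1) =
    X 0 * ∏ j : Fin (m + 1), (X (oddVar j) * X (evenVar (j + 1)) + 1) +
      ∏ j : Fin (m + 1), (X (oddVar j) * X (evenVar j) + 1) := by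
  have hIcc : ∀ G : ℕ → MvPolynomial (Fin (2 * (m + 1) + 1)) R,
      ∏ j ∈ Finset.Icc 1 (m + 1), G j = ∏ j : Fin (m + 1), G (j + 1) := by
    intro G
    rw [← Finset.prod_range (fun j => G (j + 1)), Finset.range_eq_Ico, Finset.prod_Ico_add' G]
    rfl
  have hx : ∀ k (i : Fin (2 * (m + 1) + 1)), k ≠ 2 * (m + 1) + 2 → k - 1 = i.val →
      xvar R (m + 1) k = X i := by
    intro k i hk hi
    rw [xvar, if_neg hk]
    congr 1
    ext
    rw [Fin.val_ofNat, hi, Nat.mod_eq_of_lt i.isLt]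
  have hodd : ∀ j : Fin (m + 1), xvar R (m + 1) (2 * (j + 1) + 1) = X (oddVar j) := fun j =>
    hx _ _ (by omega) (by simp only [oddVar]; omega)
  have heven : ∀ j : Fin (m + 1), xvar R (m + 1) (2 * (j + 1)) = X (evenVar j) := fun j =>
    hx _ _ (by omega) (by simp only [evenVar]; omega)
  have heven' : ∀ j : Fin (m + 1), xvar R (m + 1) (2 * (j + 1) + 2) = X (evenVar (j + 1)) := by
    intro j
    by_cases hj : j = Fin.last m
    · have hj' : (j : ℕ) = m := by rw [hj]; rfl
      have h0 : (((j + 1 : Fin (m + 1))) : ℕ) = 0 := by rw [hj, Fin.last_add_one]; rfl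
      rw [xvar, if_pos (by omega)]
      congr 1
      ext
      rw [Fin.val_ofNat, Nat.mod_eq_of_lt (by omega)]
      simp only [evenVar, h0]
    · have h1 : ((j + 1 : Fin (m + 1)) : ℕ) = j + 1 := by
        rw [Fin.val_add_one, if_neg hj]
      have hj' : (j : ℕ) < m := Fin.val_lt_last hj
      exact hx _ _ (by omega) (by simp only [evenVar, h1]; omega)
  rw [fPoly, hIcc, hIcc, hx 1 0 (by omega) rfl]
  simp only [hodd, heven, heven', mul_comm (X (evenVar _)) (X (oddVar _))]

/-- The multihomogeneous version of `fPoly`. -/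
def fForm {A : Type*} [CommRing A] {m : ℕ} (u v : Fin (2 * (m + 1) + 1) → A) : A :=
  u 0 * ∏ j : Fin (m + 1), (u (oddVar j) * u (evenVar (j + 1)) + v (oddVar j) * v (evenVar (j + 1)))
    + v 0 * ∏ j : Fin (m + 1), (u (oddVar j) * u (evenVar j) + v (oddVar j) * v (evenVar j))

/-- The index sets do not depend on the ring, so one expansion serves both for reading off
coefficients over a polynomial ring and for evaluating the form over R. -/
theorem exists_fForm_eq_sum.{w} (m : ℕ) :
    ∃ T T' : Finset (Fin (m + 1)) → Finset (Fin (2 * (m + 1) + 1)),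
      ∀ (A : Type w) [CommRing A] (u v : Fin (2 * (m + 1) + 1) → A), fForm u v =
        ∑ J, (∏ i, if i ∈ T J then v i else u i) + ∑ J, ∏ i, if i ∈ T' J then v i else u i := by
  classical
  refine ⟨fun J => Finset.univ.filter fun i => ¬ (i = 0 ∨ (∃ j ∈ J, i = oddVar j) ∨
    ∃ j ∈ J, i = evenVar (j + 1)), fun J => Finset.univ.filter fun i =>
      ¬ ((∃ j ∈ J, i = oddVar j) ∨ ∃ j ∈ J, i = evenVar j), ?_⟩
  intro A _ u v
  rw [fForm, prod_add_univ, prod_add_univ, Finset.mul_sum, Finset.mul_sum]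
  congr 1
  · refine Finset.sum_congr rfl fun J _ => ?_
    rw [prod_univ_odd_even]
    congr 1
    · simp
    · rw [← Equiv.prod_comp (Equiv.addRight (1 : Fin (m + 1)))
        (fun j => if evenVar j ∈ _ then v (evenVar j) else u (evenVar j)),
        ← Finset.prod_mul_distrib]
      refine Finset.prod_congr rfl fun j _ => ?_
      by_cases h : j ∈ J <;> simp [h]
  · refine Finset.sum_congr rfl fun J _ => ?_
    rw [prod_univ_odd_even]
    congr 1
    · simp
    · rw [← Finset.prod_mul_distrib]
      refine Finset.prod_congr rfl fun j _ => ?_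
      by_cases h : j ∈ J <;> simp [h]

theorem fForm_X_one {R : Type*} [CommRing R] (m : ℕ) :
    fForm (X : _ → MvPolynomial (Fin (2 * (m + 1) + 1)) R) 1 = fPoly R (m + 1) := by
  simp [fForm, fPoly_eq]

theorem coeffVec_fPoly_spec (R : Type*) [CommRing R] (m : ℕ) :
    multiaffinePoly (coeffVec (fPoly R (m + 1))) = fPoly R (m + 1) ∧
    ∀ u v, homForm (coeffVec (fPoly R (m + 1))) u v = fForm u v := by
  obtain ⟨T, T', h⟩ := exists_fForm_eq_sum m
  have hX : ∀ S : Finset (Fin (2 * (m + 1) + 1)),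
      (∏ i, if i ∈ S then (1 : Fin _ → MvPolynomial _ R) i else X i) =
        multiaffinePoly (Pi.single S 1) := by
    intro S
    rw [← prod_compl_mul_prod_eq, multiaffinePoly, Finset.sum_eq_single S]
    · simp
    · intro U _ hU; simp [hU]
    · simp
  have hadd : ∀ a b : Finset (Fin (2 * (m + 1) + 1)) → R,
      multiaffinePoly (a + b) = multiaffinePoly a + multiaffinePoly b := by
    intro a b
    simp [multiaffinePoly, add_mul, Finset.sum_add_distrib]
  have hsum : ∀ a : Finset (Fin (m + 1)) → Finset (Fin (2 * (m + 1) + 1)) → R,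
      multiaffinePoly (∑ J, a J) = ∑ J, multiaffinePoly (a J) := by
    intro a
    simp only [multiaffinePoly, Finset.sum_apply, map_sum, Finset.sum_mul]
    exact Finset.sum_comm
  have hf : fPoly R (m + 1) =
      multiaffinePoly (∑ J, Pi.single (T J) 1 + ∑ J, Pi.single (T' J) 1) := by
    rw [← fForm_X_one, h, hadd, hsum, hsum]
    simp only [hX]
  refine ⟨by rw [hf, coeffVec_multiaffinePoly], fun u v => ?_⟩
  rw [hf, coeffVec_multiaffinePoly, homForm_add, homForm_sum, homForm_sum, h]
  simp only [homForm_single]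

end FPoly

/-! ### Fixing one variable of f_{2n+1} leaves a determinant. -/

section Specialization
variable {R : Type*} [CommRing R]

/-- If k = 0, the constants p and q are absorbed into one factor of each product. Otherwise x_k lies
in one factor of each product; fixing it makes that factor linear in its other variable, and
multiplying by the prefactor u 0 or v 0 makes it bilinear again. So x_1 takes the place of x_k in
the cycle. -/
theorem exists_det_eq_fForm (m : ℕ) (k : Fin (2 * (m + 1) + 1)) (p q : R) :
    ∃ τ : Fin (m + 1) ⊕ Fin (m + 1) → Fin (2 * (m + 1) + 1), Function.Injective τ ∧
      (∀ i, τ i ≠ k) ∧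
      ∃ B C : Matrix (Fin (m + 1) ⊕ Fin (m + 1)) (Fin (m + 1) ⊕ Fin (m + 1)) R,
        ∀ u v, u k = p → v k = q →
          fForm u v = (Matrix.diagonal (u ∘ τ) * B + Matrix.diagonal (v ∘ τ) * C).det := by
  rcases eq_zero_or_oddVar_or_evenVar k with rfl | ⟨i, rfl⟩ | ⟨i, rfl⟩
  · obtain ⟨B, C, h⟩ := exists_rowDet_cyclic m (fun j => if j = 0 then q else 1) 0 0
      (fun j => if j = 0 then q else 1) (fun j => if j = 0 then p else 1) 0 0
      (fun j => if j = 0 then p else 1)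
    refine ⟨Sum.elim oddVar evenVar, ?_, ?_, B, C, fun u v hu hv => ?_⟩
    · rintro (i | i) (j | j) h <;> simp_all
    · rintro (i | i) <;> simp
    · rw [h, fForm, hu, hv]
      have e : ∀ (c : R) (a b : Fin (m + 1) → R), c * ∏ j, (a j + b j) =
          ∏ j, ((if j = 0 then c else 1) * (a j + b j)) := by
        intro c a b
        rw [Finset.prod_mul_distrib]
        simp
      rw [e, e, add_comm]
      congr 1 <;> refine Finset.prod_congr rfl fun j _ => ?_ <;> by_cases hj : j = 0 <;>
        simp [hj] <;> ring
  · obtain ⟨B, C, h⟩ := exists_rowDet_cyclic m (fun j => if j = i then q else 1)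
      (fun j => if j = i then p else 0) 0 (fun j => if j = i then 0 else 1)
      (fun j => if j = i then 0 else 1) 0
      (fun j => if j = i then q else 0) (fun j => if j = i then p else 1)
    refine ⟨Sum.elim (fun j => if j = i then 0 else oddVar j) evenVar, ?_, ?_, B, C,
      fun u v hu hv => ?_⟩
    · rintro (a | a) (b | b) h <;> simp only [Sum.elim_inl, Sum.elim_inr] at h
      · split_ifs at h <;> simp_all
      · split_ifs at h <;> simp_all
      · split_ifs at h <;> simp_all
      · simp_all
    · rintro (a | a)
      · simp only [Sum.elim_inl]; split_ifs with h <;> simp_all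
      · simp
    · rw [h, fForm, add_comm]
      congr 1
      · rw [← Finset.mul_prod_erase Finset.univ _ (Finset.mem_univ i),
          ← Finset.mul_prod_erase Finset.univ (fun _ => _ * _ + _ * _) (Finset.mem_univ i), ← mul_assoc]
        congr 1
        · simp [hu, hv]; ring
        · refine Finset.prod_congr rfl fun j hj => ?_
          simp [Finset.ne_of_mem_erase hj]; ring
      · rw [← Finset.mul_prod_erase Finset.univ _ (Finset.mem_univ i),
          ← Finset.mul_prod_erase Finset.univ (fun _ => _ * _ + _ * _) (Finset.mem_univ i), ← mul_assoc]
        congr 1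
        · simp [hu, hv]; ring
        · refine Finset.prod_congr rfl fun j hj => ?_
          simp [Finset.ne_of_mem_erase hj]; ring
  · obtain ⟨B, C, h⟩ := exists_rowDet_cyclic m (fun j => if j = i then q else 1) 0
      (fun j => if j = i then p else 0) (fun j => if j = i then 0 else 1)
      (fun j => if j + 1 = i then 0 else 1) (fun j => if j + 1 = i then q else 0) 0
      (fun j => if j + 1 = i then p else 1)
    refine ⟨Sum.elim oddVar (fun j => if j = i then 0 else evenVar j), ?_, ?_, B, C,
      fun u v hu hv => ?_⟩
    · rintro (a | a) (b | b) h <;> simp only [Sum.elim_inl, Sum.elim_inr] at h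
      · simp_all
      · split_ifs at h <;> simp_all
      · split_ifs at h <;> simp_all
      · split_ifs at h <;> simp_all
    · rintro (a | a)
      · simp
      · simp only [Sum.elim_inr]; split_ifs with h <;> simp_all
    · rw [h, fForm, add_comm]
      congr 1
      · rw [← Finset.mul_prod_erase Finset.univ _ (Finset.mem_univ i),
          ← Finset.mul_prod_erase Finset.univ (fun _ => _ * _ + _ * _) (Finset.mem_univ i), ← mul_assoc]
        congr 1
        · simp [hu, hv]; ring
        · refine Finset.prod_congr rfl fun j hj => ?_
          simp [Finset.ne_of_mem_erase hj]; ring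
      -- In the shifted product the fixed even variable i sits in the factor with index i - 1.
      · rw [← Finset.mul_prod_erase Finset.univ _ (Finset.mem_univ (i - 1)),
          ← Finset.mul_prod_erase Finset.univ (fun _ => _ * _ + _ * _) (Finset.mem_univ (i - 1)),
          ← mul_assoc]
        congr 1
        · simp [hu, hv]; ring
        · refine Finset.prod_congr rfl fun j hj => ?_
          have : j + 1 ≠ i := fun h => Finset.ne_of_mem_erase hj (by rw [← h]; simp)
          simp [this]; ring

theorem exists_rowDet_eq_actVec_fPoly (m : ℕ)
    (γ : Fin (2 * (m + 1) + 1) → Matrix.SpecialLinearGroup (Fin 2) R)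
    (π : Equiv.Perm (Fin (2 * (m + 1) + 1))) :
    ∃ B C : Matrix (Fin (2 * (m + 1))) (Fin (2 * (m + 1))) R, ∀ T : Finset (Fin (2 * (m + 1))),
      actVec γ π (coeffVec (fPoly R (m + 1))) (T.map (Fin.castLEEmb (Nat.le_succ _))) =
        rowDet B C T := by
  let l : Fin (2 * (m + 1) + 1) := Fin.last _
  -- The sets T avoid the last index, so the variable moved there by π is always evaluated at the
  -- first column of γ; this is the variable to fix.
  obtain ⟨τ, hτ, hτk, B, C, h⟩ :=
    exists_det_eq_fForm m (π.symm l) ((γ l).1 0 0) ((γ l).1 1 0)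
  have hl : ∀ i, π (τ i) ≠ l := fun i hi => hτk i (by rw [← hi]; simp)
  let ε : Fin (m + 1) ⊕ Fin (m + 1) → Fin (2 * (m + 1)) := fun i => (π (τ i)).castPred (hl i)
  have hε : Function.Bijective ε := by
    rw [Fintype.bijective_iff_injective_and_card]
    refine ⟨fun i j hij => ?_, by simp [two_mul]⟩
    exact hτ (π.injective (Fin.castPred_inj.1 hij))
  let e := Equiv.ofBijective ε hε
  have he : ∀ i, π (τ i) = (e i).castSucc := fun i =>
    (Fin.castSucc_castPred (π (τ i)) (hl i)).symm
  have hmem : ∀ (T : Finset (Fin (2 * (m + 1)))) i,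
      π (τ i) ∈ T.map (Fin.castLEEmb (Nat.le_succ _)) ↔ e i ∈ T := by
    intro T i
    rw [he]
    exact Finset.mem_map' (Fin.castLEEmb (Nat.le_succ (2 * (m + 1))))
  have hnot : ∀ T : Finset (Fin (2 * (m + 1))), l ∉ T.map (Fin.castLEEmb (Nat.le_succ _)) := by
    intro T hT
    obtain ⟨i, _, hi⟩ := Finset.mem_map.1 hT
    exact (Fin.castSucc_lt_last i).ne hi
  let B' := Matrix.diagonal (fun i => (γ (π (τ i))).1 0 0) * B +
    Matrix.diagonal (fun i => (γ (π (τ i))).1 1 0) * C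
  let C' := Matrix.diagonal (fun i => (γ (π (τ i))).1 0 1) * B +
    Matrix.diagonal (fun i => (γ (π (τ i))).1 1 1) * C
  refine ⟨B'.submatrix e.symm e.symm, C'.submatrix e.symm e.symm, fun T => ?_⟩
  rw [actVec_eq_homForm, (coeffVec_fPoly_spec R m).2, h _ _ (by simp [hnot]) (by simp [hnot]),
    ← Matrix.det_submatrix_equiv_self e.symm, rowDet]
  congr 1
  ext i j
  have := hmem T (e.symm i)
  rw [e.apply_symm_apply] at this
  simp only [Matrix.submatrix_apply, Matrix.add_apply, Matrix.diagonal_mul, Function.comp_apply,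
    this, Matrix.of_apply, B', C']
  by_cases hi : i ∈ T <;> simp [hi]

end Specialization

/-! ### Principal minors as mixed-row determinants. -/

section PrincipalMinors
variable {R : Type*} [CommRing R] {n : ℕ}

theorem principalMinors_eq_rowDet (A : Matrix (Fin n) (Fin n) R) :
    principalMinors A = rowDet 1 A := by
  funext S
  symm
  rw [rowDet, Matrix.twoBlockTriangular_det _ (fun i => i ∈ S)]
  · have h2 : ((Matrix.of fun i j => if i ∈ S then A i j else (1 : Matrix _ _ R) i j).toSquareBlockProp
        fun i => ¬ i ∈ S) = 1 := by
      ext i j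
      have := i.2
      simp only [Matrix.toSquareBlockProp_def, Matrix.of_apply, if_neg this, Matrix.one_apply,
        Subtype.ext_iff]
    have h1 : ((Matrix.of fun i j => if i ∈ S then A i j else (1 : Matrix _ _ R) i j).toSquareBlockProp
        fun i => i ∈ S) = A.submatrix (fun i : S => (i : Fin n)) (fun i : S => (i : Fin n)) := by
      ext i j
      have := i.2
      simp only [Matrix.toSquareBlockProp_def, Matrix.of_apply, if_pos this, Matrix.submatrix_apply]
    rw [h1, h2, Matrix.det_one, mul_one, principalMinors]
    congr!
  · intro i hi j hj
    have : i ≠ j := fun h => hi (h ▸ hj)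
    simp [hi, this]

theorem multiaffinePoly_principalMinors (A : Matrix (Fin n) (Fin n) R) :
    multiaffinePoly (principalMinors A) = (Matrix.diagonal X + A.map C).det := by
  have h := homForm_rowDet (1 : Matrix (Fin n) (Fin n) (MvPolynomial (Fin n) R)) (A.map C) X 1
  have h1 : (1 : Matrix (Fin n) (Fin n) (MvPolynomial (Fin n) R)) =
      (1 : Matrix (Fin n) (Fin n) R).map C :=
    (Matrix.map_one _ (map_zero _) (map_one _)).symm
  rw [show Matrix.diagonal (1 : Fin n → MvPolynomial (Fin n) R) = 1 from Matrix.diagonal_one,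
    one_mul, mul_one] at h
  rw [← h, h1, multiaffinePoly, principalMinors_eq_rowDet, homForm]
  simp [rowDet_map]

/-- This reaches singular B over any ring by doubling the size instead of perturbing B, which
matters for part (a) when the field is finite. The element w in the last n positions selects the
rows of A there, and T chooses between identity rows and rows of A in the first n. -/
theorem exists_actVec_principalMinors_eq_rowDet (B C : Matrix (Fin n) (Fin n) R) :
    ∃ (A : Matrix (Fin (n + n)) (Fin (n + n)) R)
      (γ : Fin (n + n) → Matrix.SpecialLinearGroup (Fin 2) R),
      ∀ T : Finset (Fin n), actVec γ 1 (principalMinors A)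
        (T.map (Fin.castLEEmb (Nat.le_add_right n n))) = rowDet B C T := by
  let w : Matrix.SpecialLinearGroup (Fin 2) R := ⟨!![0, -1; 1, 0], by simp [Matrix.det_fin_two]⟩
  let e : Fin n ⊕ Fin n ≃ Fin (n + n) := finSumFinEquiv
  let A := (Matrix.fromBlocks 0 1 (-C.transpose) B.transpose).submatrix e.symm e.symm
  refine ⟨A, fun i => if i.val < n then 1 else w, fun T => ?_⟩
  have hl : ∀ i : Fin n, Fin.castAdd n i ∈ T.map (Fin.castLEEmb (Nat.le_add_right n n)) ↔ i ∈ T :=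
    fun i => Finset.mem_map' (Fin.castLEEmb (Nat.le_add_right n n))
  have hr : ∀ i : Fin n, Fin.natAdd n i ∉ T.map (Fin.castLEEmb (Nat.le_add_right n n)) := by
    intro i hi
    obtain ⟨j, _, hj⟩ := Finset.mem_map.1 hi
    have := congrArg Fin.val hj
    simp only [Fin.castLEEmb_apply, Fin.val_castLE, Fin.val_natAdd] at this
    omega
  let d : Fin n → R := fun i => if i ∈ T then 1 else 0
  let d' : Fin n → R := fun i => if i ∈ T then 0 else 1
  have hdd : ∀ i, d' i + d i = 1 := fun i => by by_cases h : i ∈ T <;> simp [d, d', h]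
  suffices key : ∀ U V : Fin (n + n) → R, (∀ i, U (e (.inl i)) = d' i) →
      (∀ i, U (e (.inr i)) = 0) → (∀ i, V (e (.inl i)) = d i) → (∀ i, V (e (.inr i)) = 1) →
      (Matrix.diagonal U + Matrix.diagonal V * A).det = rowDet B C T by
    rw [actVec_eq_homForm, principalMinors_eq_rowDet, homForm_rowDet, mul_one]
    apply key <;> intro i <;>
      simp only [Equiv.Perm.one_apply, e, finSumFinEquiv_apply_left, finSumFinEquiv_apply_right,
        hl, hr]
    · simp [d']
    · simp [w]
    · simp [d]
    · simp [w]
  clear_value e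
  intro U V hU hU' hV hV'
  rw [← Matrix.det_submatrix_equiv_self e]
  have e1 : (Matrix.diagonal U + Matrix.diagonal V * A).submatrix e e =
      Matrix.fromBlocks (Matrix.diagonal d') (Matrix.diagonal d) (-C.transpose) B.transpose := by
    ext (i | i) (j | j) <;>
      simp [A, hU, hU', hV, hV', Matrix.diagonal_mul, Matrix.diagonal_apply, Matrix.one_apply]
  rw [e1]
  -- Since d' + d = 1, adding the second block column to the first creates an identity block, whose
  -- Schur complement takes column i from Cᵀ for i in T and from Bᵀ otherwise.
  have e2 : Matrix.fromBlocks (Matrix.diagonal d') (Matrix.diagonal d) (-C.transpose) B.transpose *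
      Matrix.fromBlocks 1 0 1 1 =
      Matrix.fromBlocks 1 (Matrix.diagonal d) (B.transpose - C.transpose) B.transpose := by
    rw [Matrix.fromBlocks_multiply]
    congr 1
    · ext i j
      by_cases h : i = j
      · subst h; simp [hdd]
      · simp [h]
    · simp
    · simp [sub_eq_neg_add]
    · simp
  have e3 := congrArg Matrix.det e2
  rw [Matrix.det_mul, Matrix.det_fromBlocks_zero₁₂, Matrix.det_fromBlocks_one₁₁] at e3
  simp only [Matrix.det_one, mul_one] at e3
  rw [e3, ← Matrix.det_transpose, rowDet]
  congr 1
  ext i j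
  by_cases h : i ∈ T <;> simp [h, d, Matrix.mul_diagonal]

end PrincipalMinors

theorem rayleigh_map {R R' : Type*} [CommRing R] [CommRing R'] (φ : R →+* R') {n : ℕ} (i j : Fin n)
    (f : MvPolynomial (Fin n) R) : map φ (rayleigh i j f) = rayleigh i j (map φ f) := by
  simp only [rayleigh, map_sub, map_mul, pderiv_map]

theorem fPoly_map {R R' : Type*} [CommRing R] [CommRing R'] (φ : R →+* R') (m : ℕ) :
    map φ (fPoly R (m + 1)) = fPoly R' (m + 1) := by
  simp [fPoly_eq]

/-- For f = x_1 α + β the Rayleigh difference is α ∂₂β - β ∂₂α. Here α and β each have a single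
factor containing x_2, and the x_2-terms of the difference cancel. -/
theorem rayleigh_fPoly_eq_prod (R : Type*) [CommRing R] (m : ℕ) :
    rayleigh 0 1 (fPoly R (m + 2)) = (X (oddVar 0) - X (oddVar (Fin.last (m + 1)))) *
      ((∏ j : Fin (m + 1), (X (oddVar j.castSucc) * X (evenVar j.succ) + 1)) *
        ∏ j : Fin (m + 1), (X (oddVar j.succ) * X (evenVar j.succ) + 1)) := by
  let l := Fin.last (m + 1)
  let Q : MvPolynomial (Fin (2 * (m + 2) + 1)) R :=
    ∏ j : Fin (m + 1), (X (oddVar j.castSucc) * X (evenVar j.succ) + 1)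
  let Q' : MvPolynomial (Fin (2 * (m + 2) + 1)) R :=
    ∏ j : Fin (m + 1), (X (oddVar j.succ) * X (evenVar j.succ) + 1)
  have hf : fPoly R (m + 2) = X 0 * (Q * (X (oddVar l) * X 1 + 1)) + (X (oddVar 0) * X 1 + 1) * Q' := by
    have h1 : evenVar (0 : Fin (m + 2)) = 1 := by ext; simp [evenVar]
    rw [fPoly_eq, Fin.prod_univ_castSucc, Fin.prod_univ_succ (n := m + 1)]
    simp only [Fin.coeSucc_eq_succ, Fin.last_add_one, h1]
    rfl
  have hval : (1 : Fin (2 * (m + 2) + 1)).val = 1 := Nat.mod_eq_of_lt (show 1 < 2 * (m + 2) + 1 by omega)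
  have h1 : ∀ j : Fin (m + 1), (1 : Fin (2 * (m + 2) + 1)) ≠ evenVar j.succ := fun j h => by
    have := congrArg Fin.val h
    simp only [evenVar, hval, Fin.val_succ] at this
    omega
  have h1' : ∀ j : Fin (m + 2), (1 : Fin (2 * (m + 2) + 1)) ≠ oddVar j := fun j h => by
    have := congrArg Fin.val h
    simp only [oddVar, hval] at this
    omega
  have h01 : (0 : Fin (2 * (m + 2) + 1)) ≠ 1 := by
    intro h
    have := congrArg Fin.val h
    simp at this
  have hQ : ∀ k : Fin (2 * (m + 2) + 1), (k = 0 ∨ k = 1) → pderiv k Q = 0 ∧ pderiv k Q' = 0 := by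
    rintro k (rfl | rfl)
    · constructor <;> refine derivation_prod_eq_zero _ _ _ fun j _ => ?_ <;>
        simp
    · constructor <;> refine derivation_prod_eq_zero _ _ _ fun j _ => ?_ <;>
        simp [(h1 _).symm, (h1' _).symm]
  change _ = (X (oddVar 0) - X (oddVar l)) * (Q * Q')
  obtain ⟨hQ0, hQ0'⟩ := hQ 0 (Or.inl rfl)
  obtain ⟨hQ1, hQ1'⟩ := hQ 1 (Or.inr rfl)
  clear_value Q Q'
  rw [rayleigh, hf]
  simp only [map_add, pderiv_mul, hQ0, hQ0', hQ1, hQ1', pderiv_X_self, pderiv_X_of_ne h01,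
    pderiv_X_of_ne h01.symm, pderiv_X_of_ne (h1' _).symm, pderiv_one,
    pderiv_X_of_ne (oddVar_ne_zero _), mul_zero, zero_mul, add_zero, zero_add, mul_one, one_mul]
  ring

/-- The two products interleave into one path x_3, x_4, …, closed by the difference of its end
variables. -/
theorem rayleigh_fPoly (R : Type*) [CommRing R] (m : ℕ) :
    rayleigh 0 1 (fPoly R (m + 2)) =
      (X (Fin.ofNat _ (0 + 2)) - X (Fin.ofNat _ (2 * (m + 1) + 2))) *
        ∏ i ∈ Finset.range (2 * (m + 1)),
          (X (Fin.ofNat _ (i + 2)) * X (Fin.ofNat _ (i + 1 + 2)) + 1) := by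
  have hprod : ∀ (k : ℕ) (G : ℕ → MvPolynomial (Fin (2 * (m + 2) + 1)) R),
      ∏ i ∈ Finset.range (2 * k), G i =
        (∏ j ∈ Finset.range k, G (2 * j)) * ∏ j ∈ Finset.range k, G (2 * j + 1) := by
    intro k G
    induction k with
    | zero => simp
    | succ k ih =>
      rw [show 2 * (k + 1) = 2 * k + 1 + 1 by ring, Finset.prod_range_succ,
        Finset.prod_range_succ, ih, Finset.prod_range_succ, Finset.prod_range_succ]
      ring
  have hodd : ∀ (k : ℕ) (j : Fin (m + 2)), k = 2 * j + 2 → Fin.ofNat (2 * (m + 2) + 1) k = oddVar j := by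
    rintro k j rfl
    ext; simp only [Fin.val_ofNat, oddVar]; exact Nat.mod_eq_of_lt (by omega)
  have heven : ∀ (k : ℕ) (j : Fin (m + 2)), k = 2 * j + 1 → Fin.ofNat (2 * (m + 2) + 1) k = evenVar j := by
    rintro k j rfl
    ext; simp only [Fin.val_ofNat, evenVar]; exact Nat.mod_eq_of_lt (by omega)
  rw [rayleigh_fPoly_eq_prod, hprod, Finset.prod_range, Finset.prod_range, hodd (0 + 2) 0 (by simp),
    hodd (2 * (m + 1) + 2) (Fin.last (m + 1)) (by simp)]
  refine congrArg₂ _ rfl (congrArg₂ _ ?_ ?_)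
  · refine Finset.prod_congr rfl fun j _ => ?_
    have h1 := hodd (2 * j + 2) j.castSucc (by rw [Fin.val_castSucc])
    have h2 := heven (2 * j + 1 + 2) j.succ (by rw [Fin.val_succ]; ring)
    rw [h1, h2]
  · refine Finset.prod_congr rfl fun j _ => ?_
    have h1 := hodd (2 * j + 1 + 1 + 2) j.succ (by rw [Fin.val_succ]; ring)
    have h2 := heven (2 * j + 1 + 2) j.succ (by rw [Fin.val_succ]; ring)
    rw [h1, h2, mul_comm (X (oddVar _))]

theorem rayleigh_fPoly_not_mul (k : Type*) [Field k] (m : ℕ)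
    {g h : MvPolynomial (Fin (2 * (m + 2) + 1)) k} (hg : IsMultiaffine g) (hh : IsMultiaffine h) :
    rayleigh 0 1 (fPoly k (m + 2)) ≠ g * h := by
  intro e
  rw [rayleigh_fPoly] at e
  refine odd_cycle_not_mul (w := fun i => Fin.ofNat _ (i + 2)) (m := m + 1) (by omega) ?_ hg hh e
  intro i hi j hj hij
  have := congrArg Fin.val hij
  simp only [Set.mem_Iic] at hi hj
  simp only [Fin.val_ofNat] at this
  rw [Nat.mod_eq_of_lt (by omega), Nat.mod_eq_of_lt (by omega)] at this
  omega

/-! ### Homogeneous equations and the variety of the ideal. -/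

section Homogeneous

theorem aeval_smul_of_isHomogeneous {σ R A : Type*} [CommRing R] [CommRing A] [Algebra R A]
    {P : MvPolynomial σ R} {d : ℕ} (hP : P.IsHomogeneous d) (c : A) (a : σ → A) :
    aeval (fun i => c * a i) P = c ^ d * aeval a P := by
  rw [aeval_def, aeval_def, eval₂_eq, eval₂_eq, Finset.mul_sum]
  refine Finset.sum_congr rfl fun m hm => ?_
  have h : ∑ i ∈ m.support, m i = d := by
    have := hP.degree_eq_sum_deg_support hm
    rw [this]
  simp only [mul_pow, Finset.prod_mul_distrib, Finset.prod_pow_eq_pow_sum, h]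
  ring

theorem mem_variety_minorIdeal {F K : Type*} [Field F] [Field K] [Algebra F K] {n : ℕ}
    {a : Finset (Fin n) → F} :
    a ∈ variety (minorIdeal F K n : Set (MvPolynomial (Finset (Fin n)) F)) ↔
      ∀ P d, P.IsHomogeneous d → (∀ A : Matrix (Fin n) (Fin n) K, aeval (principalMinors A) P = 0) →
        eval a P = 0 := by
  constructor
  · intro h P d hd hP
    exact h P (Ideal.subset_span ⟨⟨d, hd⟩, hP⟩)
  · intro h P hP
    have : minorIdeal F K n ≤ RingHom.ker (eval a) := by
      refine Ideal.span_le.2 ?_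
      rintro Q ⟨⟨d, hd⟩, hQ⟩
      exact h Q d hd hQ
    exact this hP

theorem map_principalMinors {R R' : Type*} [CommRing R] [CommRing R'] (φ : R →+* R') {n : ℕ}
    (A : Matrix (Fin n) (Fin n) R) (S : Finset (Fin n)) :
    φ (principalMinors A S) = principalMinors (A.map φ) S := by
  rw [principalMinors, RingHom.map_det]
  rfl

end Homogeneous

/-! ### Specializing the Rayleigh factorization through a valuation ring. -/

section Valuation

/-- Dividing by a coefficient of maximal valuation puts all coefficients in V and makes one of them
equal to 1. -/
theorem exists_primitive_multiple {σ L : Type*} [Field L] (V : ValuationSubring L)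
    {g : MvPolynomial σ L} (hg : g ≠ 0) :
    ∃ (c : L) (g' : MvPolynomial σ V), c ≠ 0 ∧ map V.subtype g' = C c * g ∧
      map (IsLocalRing.residue V) g' ≠ 0 := by
  obtain ⟨m, hm, hmax⟩ := Finset.exists_max_image g.support (fun m => V.valuation (coeff m g))
    (support_nonempty.2 hg)
  have hm0 : coeff m g ≠ 0 := mem_support_iff.1 hm
  have hmem : C (coeff m g)⁻¹ * g ∈ Set.range (map V.subtype : MvPolynomial σ V →+* _) := by
    rw [mem_range_map_iff_coeffs_subset]
    intro x hx
    obtain ⟨k, hk, rfl⟩ := mem_coeffs_iff.1 hx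
    rw [coeff_C_mul]
    refine ⟨⟨(coeff m g)⁻¹ * coeff k g, (V.valuation_le_one_iff _).1 ?_⟩, rfl⟩
    rw [map_mul, map_inv₀]
    have hk0 : k ∈ g.support := by
      rw [mem_support_iff] at hk ⊢
      intro h0
      apply hk
      rw [coeff_C_mul, h0, mul_zero]
    have h1 := hmax k hk0
    have h2 : V.valuation (coeff m g) ≠ 0 := (map_ne_zero _).2 hm0
    calc (V.valuation (coeff m g))⁻¹ * V.valuation (coeff k g)
        ≤ (V.valuation (coeff m g))⁻¹ * V.valuation (coeff m g) := by gcongr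
      _ = 1 := inv_mul_cancel₀ h2
  obtain ⟨g', hg'⟩ := hmem
  refine ⟨(coeff m g)⁻¹, g', inv_ne_zero hm0, hg', fun h0 => ?_⟩
  have h1 : V.subtype (coeff m g') = 1 := by
    rw [← coeff_map, hg', coeff_C_mul, inv_mul_cancel₀ hm0]
  have h2 : coeff m g' = 1 := Subtype.ext h1
  have h3 := congrArg (coeff m) h0
  rw [coeff_map, h2, map_one, coeff_zero] at h3
  exact one_ne_zero h3

theorem degreeOf_map_le {σ R R' : Type*} [CommRing R] [CommRing R'] (φ : R →+* R') (i : σ)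
    (f : MvPolynomial σ R) : degreeOf i (map φ f) ≤ degreeOf i f :=
  degreeOf_le_iff.2 fun _ hm => le_degreeOf_of_mem_support i (support_map_subset _ _ hm)

/-- A factorization over the field of a valuation ring induces one over the residue field. -/
theorem exists_residue_factorization {L : Type*} [Field L] (V : ValuationSubring L) {n : ℕ}
    (Q : MvPolynomial (Fin n) V) {g h : MvPolynomial (Fin n) L} (hg : IsMultiaffine g)
    (hh : IsMultiaffine h) (e : map V.subtype Q = g * h) :
    ∃ g' h' : MvPolynomial (Fin n) (IsLocalRing.ResidueField V), IsMultiaffine g' ∧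
      IsMultiaffine h' ∧ map (IsLocalRing.residue V) Q = g' * h' := by
  have hinj : Function.Injective (map V.subtype : MvPolynomial (Fin n) V →+* _) :=
    map_injective _ Subtype.val_injective
  by_cases h0 : g * h = 0
  · have : Q = 0 := hinj (by rw [e, h0, map_zero])
    exact ⟨0, 0, fun i => by simp, fun i => by simp, by simp [this]⟩
  obtain ⟨c, g₁, hc, hg₁, hg₁'⟩ := exists_primitive_multiple V (left_ne_zero_of_mul h0)
  obtain ⟨d, h₁, hd, hh₁, hh₁'⟩ := exists_primitive_multiple V (right_ne_zero_of_mul h0)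
  have hdeg : ∀ (c : L) (g : MvPolynomial (Fin n) L) (g₁ : MvPolynomial (Fin n) V),
      IsMultiaffine g → map V.subtype g₁ = C c * g →
      IsMultiaffine (map (IsLocalRing.residue V) g₁) := by
    intro c g g₁ hg hg₁ i
    refine (degreeOf_map_le _ _ _).trans ?_
    have : degreeOf i g₁ = degreeOf i (map V.subtype g₁) := by
      rw [degreeOf_eq_sup, degreeOf_eq_sup, support_map_of_injective _ Subtype.val_injective]
    rw [this, hg₁]
    exact (degreeOf_C_mul_le _ _ _).trans (hg i)
  have hU : map V.subtype (g₁ * h₁) = C (c * d) * map V.subtype Q := by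
    rw [e, map_mul, hg₁, hh₁, map_mul]; ring
  -- Gauss's lemma: the product of primitive polynomials has a unit coefficient. As g₁ h₁ = c d Q,
  -- this puts (c d)⁻¹ in V, so the scalars can be moved back into a factor over V.
  obtain ⟨m, hm⟩ := exists_coeff_ne_zero (mul_ne_zero hg₁' hh₁')
  rw [← map_mul, coeff_map, IsLocalRing.residue_ne_zero_iff_isUnit] at hm
  obtain ⟨w, hw⟩ := hm
  have hcd : c * d ≠ 0 := mul_ne_zero hc hd
  have hcoef : ((w : V) : L) = c * d * ((coeff m Q : V) : L) := by
    have := congrArg (coeff m) hU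
    rw [coeff_map, coeff_C_mul, coeff_map, ← hw] at this
    exact this
  have hQ : Q = C (coeff m Q * (w⁻¹ : Vˣ)) * (g₁ * h₁) := by
    apply hinj
    rw [map_mul, hU, map_C, ← mul_assoc, ← C_mul]
    have h1 : V.subtype (coeff m Q * (w⁻¹ : Vˣ)) * (c * d) = 1 := by
      have h2 : ((w : V) : L) * (((w⁻¹ : Vˣ) : V) : L) = 1 := by
        rw [← MulMemClass.coe_mul, w.mul_inv, OneMemClass.coe_one]
      rw [hcoef] at h2
      rw [map_mul, ValuationSubring.subtype_apply, ValuationSubring.subtype_apply]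
      linear_combination h2
    rw [h1, C_1, one_mul]
  refine ⟨C (IsLocalRing.residue V (coeff m Q * (w⁻¹ : Vˣ))) * map (IsLocalRing.residue V) g₁,
    map (IsLocalRing.residue V) h₁, fun i => ?_, hdeg d h h₁ hh hh₁, ?_⟩
  · exact (degreeOf_C_mul_le _ _ _).trans (hdeg c g g₁ hg hg₁ i)
  · conv_lhs => rw [hQ]
    rw [map_mul, map_C, map_mul (map _) g₁, mul_assoc]

/-- A point at which every polynomial vanishes that is in the kernel of a homomorphism to a field
extends to a place of that field. -/
theorem exists_place {F σ L : Type*} [Field F] [Field L] (ψ : MvPolynomial σ F →+* L) (p : σ → F)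
    (hp : ∀ P, ψ P = 0 → eval p P = 0) :
    ∃ (V : ValuationSubring L) (ψ' : MvPolynomial σ F →+* V),
      (∀ P, (ψ' P : L) = ψ P) ∧ ∀ P, IsLocalRing.residue V (ψ' P) =
        IsLocalRing.residue V (ψ' (C (eval p P))) := by
  -- The hypothesis makes this image of the ideal of p proper, so some valuation ring contains the
  -- range of ψ and has I among its nonunits; modulo the maximal ideal every P becomes its value at
  -- p.
  let I : Ideal ψ.range := (RingHom.ker (eval p)).map ψ.rangeRestrict
  have hsurj : Function.Surjective ψ.rangeRestrict := ψ.rangeRestrict_surjective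
  have hI : I ≠ ⊤ := by
    intro h
    have h1 : (1 : ψ.range) ∈ I := h ▸ Submodule.mem_top
    obtain ⟨P, hP, hP1⟩ := (Ideal.mem_map_iff_of_surjective _ hsurj).1 h1
    have h2 : ψ P = 1 := congrArg Subtype.val hP1
    have h3 := hp (P - 1) (by rw [map_sub, h2, map_one, sub_self])
    rw [map_sub, (RingHom.mem_ker).1 hP, map_one, zero_sub, neg_eq_zero] at h3
    exact one_ne_zero h3
  obtain ⟨V, hV, hIV⟩ := I.image_subset_nonunits_valuationSubring hI
  let ψ' : MvPolynomial σ F →+* V := ψ.codRestrict V.toSubring fun P => hV ⟨P, rfl⟩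
  refine ⟨V, ψ', fun P => rfl, fun P => ?_⟩
  rw [← sub_eq_zero, ← map_sub, ← map_sub, IsLocalRing.residue_eq_zero_iff]
  have hker : P - C (eval p P) ∈ RingHom.ker (eval p) := by simp [RingHom.mem_ker]
  have := hIV ⟨_, Ideal.mem_map_of_mem ψ.rangeRestrict hker, rfl⟩
  obtain ⟨_, h⟩ := ValuationSubring.mem_nonunits_iff_exists_mem_maximalIdeal.1 this
  exact h

theorem multiaffinePoly_map {R R' : Type*} [CommRing R] [CommRing R'] (φ : R →+* R') {n : ℕ}
    (a : Finset (Fin n) → R) :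
    map φ (multiaffinePoly a) = multiaffinePoly fun S => φ (a S) := by
  simp [multiaffinePoly]

/-- The indeterminate scalar separates degrees: the component of degree d contributes exactly the
coefficient of X^d. -/
theorem aeval_homogeneousComponent_eq_zero {F σ R₀ : Type*} [Field F] [CommRing R₀] [Algebra F R₀]
    (b : σ → R₀) (P : MvPolynomial σ F)
    (hP : aeval (fun T => Polynomial.X * Polynomial.C (b T) : σ → Polynomial R₀) P = 0) (d : ℕ) :
    aeval b (homogeneousComponent d P) = 0 := by
  have hcomp : ∀ d, aeval (fun T => Polynomial.X * Polynomial.C (b T) : σ → Polynomial R₀)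
      (homogeneousComponent d P) =
        Polynomial.C (aeval b (homogeneousComponent d P)) * Polynomial.X ^ d := by
    intro d
    rw [aeval_smul_of_isHomogeneous (homogeneousComponent_isHomogeneous d P), mul_comm]
    congr 1
    rw [map_aeval, aeval_def]
    rfl
  by_cases hd : d < P.totalDegree + 1
  · have h1 := congrArg (Polynomial.coeff · d) hP
    simp only [Polynomial.coeff_zero] at h1
    rw [← sum_homogeneousComponent P, map_sum, Polynomial.finsetSum_coeff] at h1
    simp only [hcomp, Polynomial.coeff_C_mul_X_pow] at h1
    rwa [Finset.sum_ite_eq, if_pos (Finset.mem_range.2 hd)] at h1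
  · rw [homogeneousComponent_eq_zero _ _ (by omega), map_zero]

theorem eval_eq_zero_of_generic {F K : Type*} [Field F] [Field K] [Algebra F K] {n : ℕ}
    {p : Finset (Fin n) → F}
    (hp : p ∈ variety (minorIdeal F K n : Set (MvPolynomial (Finset (Fin n)) F)))
    (P : MvPolynomial (Finset (Fin n)) F)
    (hP : ∀ d, aeval (principalMinors (Matrix.of fun i j => X (i, j) :
      Matrix (Fin n) (Fin n) (MvPolynomial (Fin n × Fin n) F))) (homogeneousComponent d P) = 0) :
    eval p P = 0 := by
  rw [mem_variety_minorIdeal] at hp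
  rw [← sum_homogeneousComponent P, map_sum]
  refine Finset.sum_eq_zero fun d hd => ?_
  refine hp _ d (homogeneousComponent_isHomogeneous d P) fun A => ?_
  have h1 := congrArg (aeval (R := F) fun x : Fin n × Fin n => A x.1 x.2) (hP d)
  rw [map_zero, ← AlgHom.comp_apply, comp_aeval] at h1
  rw [← h1]
  congr 2
  funext T
  refine Eq.trans ?_ (map_principalMinors
    (aeval (R := F) fun x : Fin n × Fin n => A x.1 x.2).toRingHom _ T).symm
  congr 1
  ext a b
  simp

theorem exists_rayleigh_eq_mul_of_generic.{u} {F L : Type u} {R₀ : Type*} [Field F] [Field L]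
    [CommRing R₀] [Algebra F R₀] {n : ℕ} {p : Finset (Fin n) → F} (A₀ : Matrix (Fin n) (Fin n) R₀)
    (θ : Polynomial R₀ →+* L) (hθ : Function.Injective θ)
    (hp : ∀ P, (∀ d, aeval (principalMinors A₀) (homogeneousComponent d P) = 0) → eval p P = 0)
    (i j : Fin n) :
    ∃ (k : Type u) (_ : Field k) (φ : F →+* k) (g h : MvPolynomial (Fin n) k), IsMultiaffine g ∧
      IsMultiaffine h ∧ map φ (rayleigh i j (multiaffinePoly p)) = g * h := by
  -- The extra indeterminate gives the generic point of the cone over the minor vectors, matching an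
  -- ideal generated by homogeneous polynomials.
  let ψ₀ : MvPolynomial (Finset (Fin n)) F →ₐ[F] Polynomial R₀ :=
    aeval fun T => Polynomial.X * Polynomial.C (principalMinors A₀ T)
  obtain ⟨V, ψ', hψ', hres⟩ := exists_place (θ.comp ψ₀.toRingHom) p fun P hP =>
    hp P (aeval_homogeneousComponent_eq_zero _ P (hθ (hP.trans (map_zero θ).symm)))
  let t : L := θ Polynomial.X
  let AL : Matrix (Fin n) (Fin n) L := A₀.map (θ.comp Polynomial.C)
  let fV : MvPolynomial (Fin n) V := multiaffinePoly fun T => ψ' (X T)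
  have hfL : map V.subtype fV = C t * (pencil AL).det := by
    rw [multiaffinePoly_map, pencil, ← multiaffinePoly_principalMinors, multiaffinePoly,
      multiaffinePoly, Finset.mul_sum]
    refine Finset.sum_congr rfl fun T _ => ?_
    rw [← mul_assoc, ← C_mul]
    congr 2
    refine (hψ' _).trans ?_
    have h1 : ψ₀ (X T) = Polynomial.X * Polynomial.C (principalMinors A₀ T) := aeval_X _ _
    change θ (ψ₀ (X T)) = _
    rw [h1, map_mul]
    congr 1
    exact map_principalMinors (θ.comp Polynomial.C) A₀ T
  have hray : map V.subtype (rayleigh i j fV) =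
      (C (t * t) * (pencil AL).adjugate i j) * (pencil AL).adjugate j i := by
    rw [rayleigh_map, hfL, mul_assoc, ← rayleigh_det_pencil]
    simp only [rayleigh, pderiv_C_mul, C_mul]
    ring
  obtain ⟨g, h, hg, hh, e⟩ := exists_residue_factorization V (rayleigh i j fV)
    (fun k => (degreeOf_C_mul_le _ _ _).trans (isMultiaffine_adjugate_pencil AL i j k))
    (isMultiaffine_adjugate_pencil AL j i) hray
  refine ⟨IsLocalRing.ResidueField V, inferInstance,
    ((IsLocalRing.residue V).comp ψ').comp C, g, h, hg, hh, ?_⟩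
  rw [← e, rayleigh_map, rayleigh_map, multiaffinePoly_map, multiaffinePoly_map]
  congr 2
  funext T
  have := hres (X T)
  rw [eval_X] at this
  exact this.symm

/-- At every point of the variety of the ideal of the principal minor map, the Rayleigh differences
are products of two multiaffine polynomials over an extension field. -/
theorem exists_rayleigh_eq_mul.{u, v} {F : Type u} {K : Type v} [Field F] [Field K] [Algebra F K]
    {n : ℕ} {p : Finset (Fin n) → F}
    (hp : p ∈ variety (minorIdeal F K n : Set (MvPolynomial (Finset (Fin n)) F))) (i j : Fin n) :
    ∃ (k : Type u) (_ : Field k) (φ : F →+* k) (g h : MvPolynomial (Fin n) k), IsMultiaffine g ∧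
      IsMultiaffine h ∧ map φ (rayleigh i j (multiaffinePoly p)) = g * h :=
  exists_rayleigh_eq_mul_of_generic _
    (algebraMap (Polynomial (MvPolynomial (Fin n × Fin n) F))
      (FractionRing (Polynomial (MvPolynomial (Fin n × Fin n) F))))
    (IsFractionRing.injective _ _) (eval_eq_zero_of_generic hp) i j

end Valuation

/-- For invertible B, homogeneity reduces the claim to the minors of C B⁻¹. In general B is replaced
by t + B, and the value q(t) of the equation satisfies q · det(t + B) = 0 at every t in K; since K
is infinite and the determinant is monic in t, q = 0, and t = 0 gives the claim. -/
theorem rowDet_mem_variety_minorIdeal {F : Type*} (K : Type*) [Field F] [Field K] [Algebra F K]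
    [Infinite K] {n : ℕ} (B C : Matrix (Fin n) (Fin n) F) :
    rowDet B C ∈ variety (minorIdeal F K n : Set (MvPolynomial (Finset (Fin n)) F)) := by
  rw [mem_variety_minorIdeal]
  intro P d hd hP
  let φ := algebraMap F K
  let BX : Matrix (Fin n) (Fin n) (Polynomial K) :=
    Matrix.scalar (Fin n) Polynomial.X + (B.map φ).map Polynomial.C
  let CX : Matrix (Fin n) (Fin n) (Polynomial K) := (C.map φ).map Polynomial.C
  have heval : ∀ t : K, BX.map (Polynomial.evalRingHom t) = Matrix.scalar (Fin n) t + B.map φ ∧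
      CX.map (Polynomial.evalRingHom t) = C.map φ := by
    intro t
    constructor
    · ext i j
      by_cases h : i = j
      · subst h; simp [BX]
      · simp [BX, h]
    · ext i j
      simp [CX]
  let q : Polynomial K := aeval (rowDet BX CX) P
  have hq : ∀ t, q.eval t = aeval (rowDet (Matrix.scalar (Fin n) t + B.map φ) (C.map φ)) P := by
    intro t
    change Polynomial.evalRingHom t (aeval (rowDet BX CX) P) = _
    have e1 : (Polynomial.evalRingHom t).comp (algebraMap F (Polynomial K)) = algebraMap F K :=
      RingHom.ext fun x => by simp [Polynomial.algebraMap_apply]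
    have e2 : (fun S => Polynomial.evalRingHom t (rowDet BX CX S)) =
        rowDet (Matrix.scalar (Fin n) t + B.map φ) (C.map φ) := by
      funext S
      rw [← rowDet_map, (heval t).1, (heval t).2]
    rw [map_aeval, e1, e2]
    rfl
  have hdet : BX.det ≠ 0 := by
    have : BX = (-(B.map φ)).charmatrix := by
      ext i j
      by_cases h : i = j
      · subst h; simp [BX]
      · simp [BX, h]
    rw [this]
    exact (Matrix.charpoly_monic _).ne_zero
  have hprod : q * BX.det = 0 := by
    refine Polynomial.funext fun t => ?_
    rw [Polynomial.eval_mul, Polynomial.eval_zero, hq]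
    by_cases ht : BX.det.eval t = 0
    · rw [ht, mul_zero]
    · have hdt : BX.det.eval t = (Matrix.scalar (Fin n) t + B.map φ).det := by
        rw [← (heval t).1]
        exact RingHom.map_det (Polynomial.evalRingHom t) BX
      set Bt := Matrix.scalar (Fin n) t + B.map φ
      have hu : IsUnit Bt.det := isUnit_iff_ne_zero.2 (hdt ▸ ht)
      have h1 : rowDet Bt (C.map φ) =
          fun S => Bt.det * principalMinors (C.map φ * Bt⁻¹) S := by
        funext S
        rw [principalMinors_eq_rowDet, mul_comm, ← rowDet_mul, one_mul,
          Matrix.nonsing_inv_mul_cancel_right _ _ hu]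
      rw [h1, aeval_smul_of_isHomogeneous hd, hP, mul_zero, zero_mul]
  have hq0 : q = 0 := (mul_eq_zero.1 hprod).resolve_right hdet
  have h0 := hq 0
  rw [hq0, Polynomial.eval_zero, map_zero, zero_add] at h0
  have h1 : rowDet (B.map φ) (C.map φ) = fun S => φ (rowDet B C S) := by
    funext S; exact rowDet_map φ B C S
  rw [h1] at h0
  have h2 : φ (eval (rowDet B C) P) = aeval (fun S => φ (rowDet B C S)) P :=
    eval₂_comp_left φ (RingHom.id F) (rowDet B C) P
  exact (map_eq_zero φ).1 (h2.trans h0.symm)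

/-! ### Orbits of equations at the coefficient vector of f_{2n+1}. -/

theorem eval_incl {R : Type*} [CommRing R] {m n : ℕ} (h : m ≤ n)
    (P : MvPolynomial (Finset (Fin m)) R) (a : Finset (Fin n) → R) :
    eval a (incl h P) = eval (fun S => a (S.map (Fin.castLEEmb h))) P := by
  rw [incl, eval_rename]
  rfl

theorem mem_variety_orbit_incl {R : Type*} [CommRing R] {m n : ℕ} (h : m ≤ n)
    (E : Set (MvPolynomial (Finset (Fin m)) R)) (a : Finset (Fin n) → R) :
    a ∈ variety (orbit (incl h '' E)) ↔ ∀ γ π, ∀ P ∈ E,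
      eval (fun S => actVec γ π a (S.map (Fin.castLEEmb h))) P = 0 := by
  constructor
  · intro ha γ π P hP
    rw [← eval_incl, ← eval_actPoly]
    exact ha _ ⟨γ, π, _, ⟨P, hP, rfl⟩, rfl⟩
  · rintro ha _ ⟨γ, π, _, ⟨P, hP, rfl⟩, rfl⟩
    rw [eval_actPoly, eval_incl]
    exact ha γ π P hP

theorem actVec_one {R : Type*} [CommRing R] {n : ℕ} (a : Finset (Fin n) → R) :
    actVec 1 1 a = a := by
  have h : moebius 1 (multiaffinePoly a) = multiaffinePoly a := by
    conv_rhs => rw [multiaffinePoly]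
    simp [moebius, coeffVec_multiaffinePoly]
  rw [actVec, Equiv.Perm.coe_one, rename_id_apply, h, coeffVec_multiaffinePoly]

theorem coeffVec_fPoly_empty (R : Type*) [CommRing R] (m : ℕ) :
    coeffVec (fPoly R (m + 1)) ∅ = 1 := by
  have h1 := homForm_single (R := R) (∅ : Finset (Fin (2 * (m + 1) + 1))) 1 0
  have h2 := (coeffVec_fPoly_spec R m).2 1 0
  have h3 : homForm (coeffVec (fPoly R (m + 1))) 1 0 = coeffVec (fPoly R (m + 1)) ∅ := by
    rw [homForm, Finset.sum_eq_single ∅]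
    · simp
    · intro S _ hS
      obtain ⟨i, hi⟩ := Finset.nonempty_iff_ne_empty.2 hS
      rw [Finset.prod_eq_zero (s := S) hi rfl, mul_zero, mul_zero]
    · simp
  rw [← h3, h2]
  simp [fForm]

theorem castLE_map_map {l m n : ℕ} (h : l ≤ m) (h' : m ≤ n) (S : Finset (Fin l)) :
    (S.map (Fin.castLEEmb h)).map (Fin.castLEEmb h') = S.map (Fin.castLEEmb (h.trans h')) := by
  rw [Finset.map_map]
  rfl

theorem coeffVec_fPoly_mem_variety_orbit {R : Type*} [CommRing R] (m : ℕ) {N : ℕ}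
    (hN : N ≤ 2 * (m + 1)) (E : Set (MvPolynomial (Finset (Fin N)) R))
    (hE : ∀ P ∈ E, ∀ B C : Matrix (Fin (2 * (m + 1))) (Fin (2 * (m + 1))) R,
      eval (fun S => rowDet B C (S.map (Fin.castLEEmb hN))) P = 0) :
    coeffVec (fPoly R (m + 1)) ∈
      variety (orbit (incl (hN.trans (Nat.le_succ (2 * (m + 1)))) '' E)) := by
  rw [mem_variety_orbit_incl]
  intro γ π P hP
  obtain ⟨B, C, h⟩ := exists_rowDet_eq_actVec_fPoly m γ π
  rw [← hE P hP B C]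
  congr 2
  funext S
  rw [← h, castLE_map_map]

theorem coeffVec_fPoly_notMem_variety_minorIdeal (F K : Type*) [Field F] [Field K] [Algebra F K]
    (m : ℕ) : coeffVec (fPoly F (m + 2)) ∉ variety
      (minorIdeal F K (2 * (m + 2) + 1) : Set (MvPolynomial (Finset (Fin (2 * (m + 2) + 1))) F)) := by
  intro hmem
  obtain ⟨k, _, φ, g, h, hg, hh, e⟩ := exists_rayleigh_eq_mul hmem 0 1
  rw [(coeffVec_fPoly_spec F (m + 1)).1, rayleigh_map, fPoly_map] at e
  exact rayleigh_fPoly_not_mul k m hg hh e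

theorem principalMinors_ne_coeffVec_fPoly {F : Type*} [Field F] (m : ℕ)
    (A : Matrix (Fin (2 * (m + 2) + 1)) (Fin (2 * (m + 2) + 1)) F) :
    principalMinors A ≠ coeffVec (fPoly F (m + 2)) := by
  intro hA
  have h := congrArg multiaffinePoly hA
  rw [(coeffVec_fPoly_spec F (m + 1)).1, multiaffinePoly_principalMinors] at h
  refine rayleigh_fPoly_not_mul F m (isMultiaffine_adjugate_pencil A 0 1)
    (isMultiaffine_adjugate_pencil A 1 0) ?_
  rw [← rayleigh_det_pencil, ← h, pencil]

end PrincipalMinor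

end

theorem theorem8p1 (F K : Type*) [Field F] [Field K] [Algebra F K] [Infinite K] :
    (∀ (N : ℕ) (E : Finset (MvPolynomial (Finset (Fin N)) F)),
      (¬ ∀ (n : ℕ) (h : N ≤ n) (a : Finset (Fin n) → F), a ∅ = 1 →
        ((∃ A : Matrix (Fin n) (Fin n) F, PrincipalMinor.principalMinors A = a) ↔
          a ∈ PrincipalMinor.variety (PrincipalMinor.orbit
            (PrincipalMinor.incl h '' (E : Set (MvPolynomial (Finset (Fin N)) F)))))) ∧
      (¬ ∀ (n : ℕ) (h : N ≤ n),
        PrincipalMinor.variety (PrincipalMinor.orbit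
          (PrincipalMinor.incl h '' (E : Set (MvPolynomial (Finset (Fin N)) F)))) =
        PrincipalMinor.variety
          (PrincipalMinor.minorIdeal F K n : Set (MvPolynomial (Finset (Fin n)) F)))) ∧
    (∀ n : ℕ, 2 ≤ n →
      PrincipalMinor.coeffVec (PrincipalMinor.fPoly F n) ∈
        PrincipalMinor.variety (PrincipalMinor.orbit
          (PrincipalMinor.incl (Nat.le_succ (2 * n)) ''
            (PrincipalMinor.minorIdeal F K (2 * n) :
              Set (MvPolynomial (Finset (Fin (2 * n))) F)))) ∧
      PrincipalMinor.coeffVec (PrincipalMinor.fPoly F n) ∉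
        PrincipalMinor.variety
          (PrincipalMinor.minorIdeal F K (2 * n + 1) :
            Set (MvPolynomial (Finset (Fin (2 * n + 1))) F)) ∧
      ¬ ∃ g h : MvPolynomial (Fin (2 * n + 1)) (AlgebraicClosure F),
        PrincipalMinor.IsMultiaffine g ∧ PrincipalMinor.IsMultiaffine h ∧
        MvPolynomial.map (algebraMap F (AlgebraicClosure F))
          (PrincipalMinor.rayleigh 0 1 (PrincipalMinor.fPoly F n)) = g * h) := by
  open PrincipalMinor in
  refine ⟨fun N E => ⟨fun hyp => ?_, fun hyp => ?_⟩, fun n hn => ?_⟩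
  -- The counterexample is f_{2n+1} with n = N + 2, so that n ≥ 2 and 2n ≥ N. The assumed
  -- equivalence is used at size 4n to make E vanish on all `rowDet B C` of size 2n, and then at
  -- size 2n + 1.
  · have hN : N ≤ 2 * (N + 1 + 1) := by omega
    have hmem := coeffVec_fPoly_mem_variety_orbit (R := F) (N + 1) hN E fun P hP B C => by
      obtain ⟨A, γ, hA⟩ := exists_actVec_principalMinors_eq_rowDet B C
      have h0 : principalMinors A ∅ = 1 := by simp [principalMinors]
      have h1 := (mem_variety_orbit_incl _ _ _).1
        ((hyp _ (hN.trans (Nat.le_add_right _ _)) _ h0).1 ⟨A, rfl⟩) γ 1 P hP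
      rw [← h1]
      congr 2
      funext S
      rw [← hA, castLE_map_map]
    obtain ⟨A, hA⟩ := (hyp _ _ _ (coeffVec_fPoly_empty F (N + 1))).2 hmem
    exact principalMinors_ne_coeffVec_fPoly N A hA
  · have hN : N ≤ 2 * (N + 1 + 1) := by omega
    refine coeffVec_fPoly_notMem_variety_minorIdeal F K N ?_
    rw [← hyp _ (hN.trans (Nat.le_succ _))]
    refine coeffVec_fPoly_mem_variety_orbit (R := F) (N + 1) hN E fun P hP B C => ?_
    -- Here the assumed equality at size 2n, with the trivial group element, already makes E vanish
    -- on `rowDet B C`.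
    have h1 := rowDet_mem_variety_minorIdeal K B C
    rw [← hyp _ hN, mem_variety_orbit_incl] at h1
    simpa only [actVec_one] using h1 1 1 P hP
  · obtain ⟨m, rfl⟩ : ∃ m, n = m + 2 := ⟨n - 2, by omega⟩
    refine ⟨?_, coeffVec_fPoly_notMem_variety_minorIdeal F K m, ?_⟩
    · refine coeffVec_fPoly_mem_variety_orbit (R := F) (m + 1) le_rfl _ fun P hP B C => ?_
      have h1 := rowDet_mem_variety_minorIdeal K B C P hP
      rw [← h1]
      congr 2
      funext S
      congr 1
      ext i
      simp
    · rintro ⟨g, h, hg, hh, e⟩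
      rw [rayleigh_map, fPoly_map] at e
      exact rayleigh_fPoly_not_mul _ m hg hh e
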